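/- For even $k\ge 2$ let $$G_k(q) = -\frac{B_k}{2k} + \sum_{n\ge 1}\sum_{d\mid n} d^{k-1} q^n \in \mathbb{C}[[q]]$$ (with $B_k$ the Bernoulli numbers), and set $G_k=0$ for odd $k$. Let $$\wp(z) = \frac{1}{z^2} + 2\sum_{k\ge 4} G_k(q)\,\frac{z^{k-2}}{(k-2)!},$$ a Laurent series in $z$ with coefficients in $\mathbb{C}[[q]]$. Let $(\wp(z)-4G_2)^{1/2} = \frac1z - 2G_2 z + \cdots$ be the formal square root with leading term $1/z$, and put $(\wp(z)-4G_2)^{k+\frac12} := (\wp(z)-4G_2)^k(\wp(z)-4G_2)^{\frac12}$. Let $\mathrm{Res}_{z=0}$ denote the coefficient of $z^{-1}$, and for $k\ge 0$ define $$A_k(q) = \frac{(-1)^k}{(2k+1)!!}\,\mathrm{Res}_{z=0}\Big[(\wp(z)-4G_2)^{k+\frac12}\Big]\in\mathbb{C}[[q]].$$ A quasimodular form of weight $w$ is an element of $\mathbb{C}[[q]]$ that is a polynomial in $G_2,G_4,G_6$ with complex coefficients, homogeneous of degree $w$ where $G_i$ has weight $i$; the series $G_2,G_4,G_6$ are algebraically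 independent, and $\frac{d}{dG_2}$ denotes the formal partial derivative on $\mathbb{C}[G_2,G_4,G_6]$. **Theorem.** The sequence $(A_k)_{k\ge 0}$ satisfies the following three conditions, and it is the only sequence of power series in $\mathbb{C}[[q]]$ satisfying them: (a) for every $k \geq 0$, $A_k(q)$ is a quasimodular form of weight $2k$, and $\frac{d}{dG_2}A_k = 2A_{k-1}$ (with $A_{-1}:=0$); (b) for every $n\ge 0$ there is a polynomial $p_n$ with complex coefficients, of degree exactly $2n$, such that for every $k\ge n$ the coefficient of $q^n$ in $A_k(q)$ equals $$\frac{1}{(-4)^k(2k+1)!!}\,p_n(k);$$ (c) $A_0 = 1+O(q)$. -/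

import Mathlib

open PowerSeries
open scoped Nat

noncomputable section

/-- The Eisenstein series `G_k(q) = -B_k/(2k) + ∑_{n ≥ 1} ∑_{d ∣ n} d^(k-1) q^n` (`k ≥ 2` even),
as a formal power series in `q`; by convention `G_k = 0` for odd `k`. -/
def eisG (k : ℕ) : ℂ⟦X⟧ :=
  if Even k then
    PowerSeries.mk fun n =>
      if n = 0 then -((bernoulli k : ℚ) : ℂ) / (2 * (k : ℂ))
      else ∑ d ∈ n.divisors, (d : ℂ) ^ (k - 1)
  else 0

/-- The regular part `2 ∑_{k ≥ 4} G_k(q) z^(k-2) / (k-2)!` of the Weierstrass function, as a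
power series in `z` whose coefficients are power series in `q`; here `k = m + 2`. -/
def wpRegular : ℂ⟦X⟧⟦X⟧ :=
  PowerSeries.mk fun m =>
    if 2 ≤ m then (2 / (m ! : ℂ)) • eisG (m + 2) else 0

/-- The Weierstrass function `℘(z) = z^(-2) + 2 ∑_{k ≥ 4} G_k(q) z^(k-2) / (k-2)!`,
a Laurent series in `z` over `ℂ⟦q⟧`. -/
def wp : LaurentSeries ℂ⟦X⟧ :=
  HahnSeries.single (-2 : ℤ) 1 + HahnSeries.ofPowerSeries ℤ ℂ⟦X⟧ wpRegular

/-- `℘(z) - 4 G_2`. -/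
def wpShift : LaurentSeries ℂ⟦X⟧ :=
  wp - HahnSeries.C (4 * eisG 2)

/-- The formal square root `(℘ - 4 G_2)^(1/2) = z^(-1) (1 + u)^(1/2)`, where
`u = z^2 (℘ - 4 G_2) - 1` has no constant term in `z` and `(1 + u)^(1/2)` is the
binomial series. -/
def sqrtWpShift : LaurentSeries ℂ⟦X⟧ :=
  HahnSeries.single (-1 : ℤ) 1 *
    HahnSeries.ofPowerSeries ℤ ℂ⟦X⟧
      ((binomialSeries ℂ⟦X⟧ (1 / 2 : ℚ)).subst
        (X ^ 2 * (wpRegular - C (4 * eisG 2)) : ℂ⟦X⟧⟦X⟧))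

/-- `A_k(q) = (-1)^k / (2k+1)!! * Res_{z=0} (℘ - 4 G_2)^(k+1/2)`; the residue is the coefficient
of `z^(-1)`, and `(℘ - 4 G_2)^(k+1/2) = (℘ - 4 G_2)^k (℘ - 4 G_2)^(1/2)`. -/
def seriesA (k : ℕ) : ℂ⟦X⟧ :=
  ((-1 : ℂ) ^ k / ((2 * k + 1)‼ : ℂ)) • (wpShift ^ k * sqrtWpShift).coeff (-1)

/-- Evaluation of a polynomial in three variables at `(G_2, G_4, G_6)`, in `ℂ⟦q⟧`. Its range is the
algebra `ℂ[G_2, G_4, G_6]` of quasimodular forms. -/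
def evalG : MvPolynomial (Fin 3) ℂ →ₐ[ℂ] ℂ⟦X⟧ :=
  MvPolynomial.aeval ![eisG 2, eisG 4, eisG 6]

/-- `f` is the `q`-expansion of a quasimodular form of weight `w`: a polynomial in `G_2, G_4, G_6`
that is homogeneous of degree `w` for the weights `2, 4, 6`. -/
def IsQuasimodular (w : ℕ) (f : ℂ⟦X⟧) : Prop :=
  ∃ P : MvPolynomial (Fin 3) ℂ, P.IsWeightedHomogeneous ![2, 4, 6] w ∧ evalG P = f

/-- `f` is quasimodular and `d/dG_2 f = g`: the formal partial derivative along `G_2` of any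
polynomial in `G_2, G_4, G_6` that represents `f` represents `g`. -/
def HasDerivG2 (f g : ℂ⟦X⟧) : Prop :=
  (∃ P, evalG P = f) ∧ ∀ P, evalG P = f → evalG (MvPolynomial.pderiv 0 P) = g

/-- Properties (a), (b), (c) of a sequence of power series in `q` (with `A_{-1} = 0` in (a)). -/
structure IsPolynomialQuasimodularSequence (A : ℕ → ℂ⟦X⟧) : Prop where
  quasimodular : ∀ k, IsQuasimodular (2 * k) (A k)
  deriv_zero : HasDerivG2 (A 0) 0
  deriv_succ : ∀ k, HasDerivG2 (A (k + 1)) (2 * A k)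
  polynomial : ∀ n : ℕ, ∃ p : Polynomial ℂ, p.degree = ((2 * n : ℕ) : WithBot ℕ) ∧
    ∀ k : ℕ, n ≤ k →
      coeff n (A k) = 1 / ((-4 : ℂ) ^ k * ((2 * k + 1)‼ : ℂ)) * p.eval (k : ℂ)
  normalized : coeff 0 (A 0) = 1

/-- The substituted series has no constant term. -/
theorem hasSubst_sqrtArg :
    PowerSeries.HasSubst (X ^ 2 * (wpRegular - C (4 * eisG 2)) : ℂ⟦X⟧⟦X⟧) :=
  PowerSeries.HasSubst.of_constantCoeff_zero' (by simp)

/-- The formal square root squares to `℘ - 4 G_2`. -/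
theorem sqrtWpShift_sq : sqrtWpShift ^ 2 = wpShift := by
  have h : (binomialSeries ℂ⟦X⟧ (1 / 2 : ℚ)) ^ 2 = 1 + X := by
    rw [sq, ← binomialSeries_add]
    have := binomialSeries_nat (R := ℚ) (A := ℂ⟦X⟧) 1
    norm_num at this ⊢
    exact this
  have h2 : (1 + X : ℂ⟦X⟧⟦X⟧).subst
      (X ^ 2 * (wpRegular - C (4 * eisG 2)) : ℂ⟦X⟧⟦X⟧) =
      1 + X ^ 2 * (wpRegular - C (4 * eisG 2)) := by
    rw [PowerSeries.subst_add hasSubst_sqrtArg, PowerSeries.subst_X hasSubst_sqrtArg,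
      ← PowerSeries.coe_substAlgHom hasSubst_sqrtArg, map_one]
  rw [sqrtWpShift, mul_pow, ← map_pow (HahnSeries.ofPowerSeries ℤ ℂ⟦X⟧),
    ← PowerSeries.subst_pow hasSubst_sqrtArg, h, h2, wpShift, wp,
    map_add, map_mul, map_sub, map_one (HahnSeries.ofPowerSeries ℤ ℂ⟦X⟧),
    map_pow (HahnSeries.ofPowerSeries ℤ ℂ⟦X⟧), HahnSeries.ofPowerSeries_X,
    HahnSeries.ofPowerSeries_C]
  have e1 : (HahnSeries.single (-1 : ℤ) (1 : ℂ⟦X⟧)) ^ 2 = HahnSeries.single (-2 : ℤ) 1 := by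
    simp [HahnSeries.single_pow]
  have e2 : HahnSeries.single (-2 : ℤ) (1 : ℂ⟦X⟧) * (HahnSeries.single (1 : ℤ) 1) ^ 2 = 1 := by
    simp [HahnSeries.single_pow]
  rw [e1, mul_add, ← mul_assoc, e2]
  ring

/-- The formal square root starts with `z^(-1)`. -/
theorem sqrtWpShift_coeff : sqrtWpShift.coeff (-1) = 1 := by
  have := HahnSeries.coeff_single_mul_add (r := (1 : ℂ⟦X⟧)) (b := (-1 : ℤ)) (a := 0)
    (x := HahnSeries.ofPowerSeries ℤ ℂ⟦X⟧
      ((binomialSeries ℂ⟦X⟧ (1 / 2 : ℚ)).subst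
        (X ^ 2 * (wpRegular - C (4 * eisG 2)) : ℂ⟦X⟧⟦X⟧)))
  rw [zero_add, one_mul] at this
  rw [sqrtWpShift, this]
  have h := HahnSeries.ofPowerSeries_apply_coeff (Γ := ℤ)
      ((binomialSeries ℂ⟦X⟧ (1 / 2 : ℚ)).subst
        (X ^ 2 * (wpRegular - C (4 * eisG 2)) : ℂ⟦X⟧⟦X⟧)) 0
  rw [Nat.cast_zero] at h
  rw [h, PowerSeries.coeff_subst' hasSubst_sqrtArg, finsum_eq_single _ 0]
  · simp
  · intro n hn
    simp [mul_pow, hn]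

end

/-!
The series `A_k` are quasimodular because a half-integral power is a binomial sum. With
`u = z² (℘ - 4 G_2) - 1`, a power series in `z` without constant term, the residue of
`(℘ - 4 G_2)^(k + 1/2)` is the coefficient of `z^(2k)` in `∑_j binom(k + 1/2, j) u^j`
(`coeff_sqrt_pow`). The coefficient of `z^m` in `u` is a multiple of `G_m`, hence a polynomial in
`G_2, G_4, G_6` of weight `m` (`exists_poly_of_modularForm`), and `G_2` occurs only in the term
`-4 G_2 z²`; termwise differentiation gives `dA_k/dG_2 = 2 A_{k-1}` (`pderiv_polyA_succ`).

The derivative along `G_2` makes sense on power series because `G_2, G_4, G_6` are algebraically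
independent (`evalG_injective`). A relation `P(G_2, G_4, G_6) = 0` holds at all points `-1/(τ + n)`,
where the transformation laws turn it into a polynomial in `t = τ + n` with infinitely many zeros.
It is therefore stable under `(x, y, z) ↦ (t² x + c t, t⁴ y, t⁶ z)` for all `t`. The composites
of these maps include all translations of `x`, so `x` is free and `(y, z)` may be scaled by
`(t⁴, t⁶)`; as `G_6² / G_4³` takes infinitely many values, `P` vanishes wherever `y ≠ 0`.

For the coefficients, exchange `z` and `q`. By `swapVars_wpArg` the constant term in `q` of
`℘ - 4 G_2` is `y²` with `y = coth (z / 2) / 2`, and the higher coefficients are polynomials in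
`c = cosh² (z / 2)`, of degree at most `n` for `q^n`. Expanding around `y²` expresses the
coefficient of `q^n` of the residue by the numbers `Res y^(2(k-j)+1) c^i` with `i, j ≤ n`. The
differential equation `y' = 1/4 - y²` evaluates these residues as `4^(j-k) binom(k - j + i, i)`
(`coeff_zCoth_pow_mul_coshSq_pow`), a polynomial in `k` of degree `i` up to the power of `4`. The
factor `binom(k + 1/2, j)` adds the degree `j`, so the total degree is at most `2n`, and only
`i = j = n` contributes to the top coefficient `4^n · 4^n / (n!)²`, because the coefficient of `q`
in `℘ - 4 G_2` is `4 c - 8` (`exists_polynomial_coeff_seriesA`).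

For uniqueness, suppose that two sequences with the three properties agree before the index `m`.
Their difference at `m` is killed by `d/dG_2`, so it is a modular form of weight `2m`
(`exists_modularForm_sub`). If `3n < m`, the polynomials of degree `2n` that govern the coefficients
of `q^n` agree at the more than `2n` points `n, …, m - 1`, so the difference has no term in `q^n`
(`coeff_eq_of_forall_lt`). As `3n < m` for all `n ≤ m / 6` when `m ≥ 1`, the Sturm bound shows that
the difference vanishes; for `m = 0` the normalization `A_0 = 1 + O(q)` plays this role.
-/

/-! ### Power series as functions on the upper half plane -/

section QExpansions

open UpperHalfPlane ModularForm EisensteinSeries MatrixGroups Function.Periodic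

/-- The function `F` on the upper half plane is the sum of the power series `f` at
`q = exp (2πiτ)`. -/
def IsQExp (f : ℂ⟦X⟧) (F : ℍ → ℂ) : Prop :=
  ∀ τ : ℍ, HasSum (fun m => coeff m f * qParam 1 τ ^ m) (F τ)

theorem IsQExp.const (a : ℂ) : IsQExp (C a) (fun _ => a) := by
  intro τ
  convert hasSum_ite_eq (0 : ℕ) a using 2 with m
  rw [coeff_C]
  split_ifs with h <;> simp [h]

theorem IsQExp.add {f g : ℂ⟦X⟧} {F G : ℍ → ℂ} (hf : IsQExp f F) (hg : IsQExp g G) :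
    IsQExp (f + g) (fun τ => F τ + G τ) := by
  intro τ
  simpa [add_mul] using (hf τ).add (hg τ)

theorem IsQExp.mul {f g : ℂ⟦X⟧} {F G : ℍ → ℂ} (hf : IsQExp f F) (hg : IsQExp g G) :
    IsQExp (f * g) (fun τ => F τ * G τ) := by
  intro τ
  have h1 := (hf τ).summable.norm
  have h2 := (hg τ).summable.norm
  have h3 := (summable_norm_sum_mul_antidiagonal_of_summable_norm h1 h2).of_norm.hasSum
  rw [← tsum_mul_tsum_eq_tsum_sum_antidiagonal_of_summable_norm h1 h2, (hf τ).tsum_eq,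
    (hg τ).tsum_eq] at h3
  convert! h3 using 2 with m
  rw [coeff_mul, Finset.sum_mul]
  refine Finset.sum_congr rfl fun p hp => ?_
  rw [← Finset.HasAntidiagonal.mem_antidiagonal.mp hp, pow_add]
  ring

/-- A power series that converges to zero on the punctured disc vanishes; this is the uniqueness of
`q`-expansions, applied to the modular form `0` (whose weight, here `4`, is irrelevant). -/
theorem IsQExp.eq_zero {f : ℂ⟦X⟧} {F : ℍ → ℂ} (hf : IsQExp f F) (hF : ∀ τ, F τ = 0) : f = 0 := by
  ext m
  have h := ModularFormClass.qExpansion_coeff_unique (f := (0 : ModularForm 𝒮ℒ 4)) one_pos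
    one_mem_strictPeriods_SL (c := fun m => coeff m f)
    (fun τ => by simpa [hF τ] using hf τ) m
  rw [h]
  simp [UpperHalfPlane.qExpansion_zero]

theorem IsQExp.apply_eq_of_qParam_eq {f : ℂ⟦X⟧} {F : ℍ → ℂ} (hf : IsQExp f F) {τ τ' : ℍ}
    (h : qParam 1 τ = qParam 1 τ') : F τ = F τ' :=
  (hf τ).unique (by rw [h]; exact hf τ')

theorem isQExp_modularForm {k : ℤ} (f : ModularForm 𝒮ℒ k) :
    IsQExp (UpperHalfPlane.qExpansion 1 f) f := by
  have : Fact (IsCusp OnePoint.infty 𝒮ℒ) :=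
    ⟨Subgroup.isCusp_of_mem_strictPeriods one_pos one_mem_strictPeriods_SL⟩
  exact fun τ => ModularForm.hasSum_qExpansion f one_pos one_mem_strictPeriods_SL τ

/-- The Bernoulli numbers of even index do not vanish, since `ζ(k) ≠ 0`. -/
theorem bernoulli_ne_zero_of_even {k : ℕ} (hk : Even k) (h0 : k ≠ 0) : bernoulli k ≠ 0 := by
  intro hB
  obtain ⟨m, rfl⟩ := hk
  rw [← two_mul] at hB h0
  have h := riemannZeta_two_mul_nat (k := m) (by omega)
  rw [hB] at h
  refine riemannZeta_ne_zero_of_one_le_re (s := 2 * m) ?_ (by rw [h]; simp)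
  have : (1 : ℝ) ≤ m := by exact_mod_cast (show 1 ≤ m by omega)
  simp
  linarith

/-- The constant term of `eisG k`. -/
noncomputable def eisConst (k : ℕ) : ℂ := -((bernoulli k : ℚ) : ℂ) / (2 * (k : ℂ))

theorem eisConst_four : eisConst 4 = 1 / 240 := by
  rw [eisConst, show bernoulli 4 = -1 / 30 by decide +kernel]
  norm_num

theorem eisConst_six : eisConst 6 = -1 / 504 := by
  rw [eisConst, show bernoulli 6 = 1 / 42 by decide +kernel]
  norm_num

theorem coeff_eisG {k : ℕ} (hk : Even k) (m : ℕ) : coeff m (eisG k) =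
    if m = 0 then eisConst k else ∑ d ∈ m.divisors, (d : ℂ) ^ (k - 1) := by
  rw [eisG, if_pos hk, coeff_mk, eisConst]

theorem eisG_of_odd {k : ℕ} (hk : Odd k) : eisG k = 0 := by
  rw [eisG, if_neg (Nat.not_even_iff_odd.mpr hk)]

theorem eisG_eq_smul_qExpansion {k : ℕ} (hk : 3 ≤ k) (hk2 : Even k) :
    eisG k = eisConst k • UpperHalfPlane.qExpansion 1 (E hk) := by
  ext m
  have h : ((bernoulli k : ℚ) : ℂ) ≠ 0 := by
    exact_mod_cast bernoulli_ne_zero_of_even hk2 (by omega)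
  have hk0 : (k : ℂ) ≠ 0 := by exact_mod_cast (show k ≠ 0 by omega)
  rw [coeff_eisG hk2, map_smul, E_qExpansion_coeff hk hk2, smul_eq_mul]
  split_ifs with hm
  · simp
  · rw [eisConst, ArithmeticFunction.sigma_apply]
    push_cast
    field_simp

theorem isQExp_eisG_two : IsQExp (eisG 2) (fun τ => -(1 / 24) * E2 τ) := by
  intro τ
  convert! (hasSum_qExpansion_E2 τ).mul_left (-(1 / 24)) using 2 with m
  rw [coeff_eisG even_two, qParam, smul_eq_mul, ← mul_assoc, ArithmeticFunction.sigma_apply]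
  congr 1
  · split_ifs
    · simp only [eisConst, bernoulli_two]
      norm_num
    · push_cast
      ring_nf
  · simp

/-- The values of the functions `G_2`, `G_4`, `G_6` at a point of the upper half plane. -/
noncomputable def eisVal (τ : ℍ) : Fin 3 → ℂ :=
  ![-(1 / 24) * E2 τ, eisConst 4 * E₄ τ, eisConst 6 * E₆ τ]

theorem isQExp_evalG (P : MvPolynomial (Fin 3) ℂ) :
    IsQExp (evalG P) (fun τ => MvPolynomial.aeval (eisVal τ) P) := by
  have hmod {k : ℕ} (hk : 3 ≤ k) (hk2 : Even k) :
      IsQExp (eisG k) (fun τ => eisConst k * E hk τ) := by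
    rw [eisG_eq_smul_qExpansion hk hk2, smul_eq_C_mul]
    exact (IsQExp.const _).mul (isQExp_modularForm _)
  induction P using MvPolynomial.induction_on with
  | C a => simpa [evalG, PowerSeries.algebraMap_apply] using IsQExp.const a
  | add P Q hP hQ => simpa using hP.add hQ
  | mul_X P i hP =>
    simp only [map_mul]
    refine hP.mul ?_
    simp only [evalG, MvPolynomial.aeval_X]
    fin_cases i
    · simpa [eisVal] using isQExp_eisG_two
    · simpa [eisVal] using hmod (k := 4) (by norm_num) (by decide)
    · simpa [eisVal] using hmod (k := 6) (by norm_num) (by decide)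

theorem evalG_eq_zero_iff (P : MvPolynomial (Fin 3) ℂ) :
    evalG P = 0 ↔ ∀ τ, MvPolynomial.aeval (eisVal τ) P = 0 := by
  refine ⟨fun h τ => ?_, fun h => (isQExp_evalG P).eq_zero h⟩
  refine (isQExp_evalG P τ).unique ?_
  simp [h]

/-- Behaviour of `(G_2, G_4, G_6)` under `τ ↦ -1/τ`. -/
theorem eisVal_S (τ : ℍ) : eisVal (ModularGroup.S • τ) =
    ![(τ : ℂ) ^ 2 * eisVal τ 0 + Complex.I / (4 * Real.pi) * τ,
      (τ : ℂ) ^ 4 * eisVal τ 1, (τ : ℂ) ^ 6 * eisVal τ 2] := by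
  have hτ : (τ : ℂ) ≠ 0 := τ.ne_zero
  have hpi : (Real.pi : ℂ) ≠ 0 := by exact_mod_cast Real.pi_ne_zero
  have hmod {k : ℕ} (f : ModularForm 𝒮ℒ k) : f (ModularGroup.S • τ) = (τ : ℂ) ^ k * f τ := by
    have := SlashInvariantForm.slash_action_eqn'' f
      (γ := (ModularGroup.S : GL (Fin 2) ℝ)) (MonoidHom.mem_range.mpr ⟨ModularGroup.S, rfl⟩) τ
    rw [← ModularGroup.sl_moeb, ModularGroup.denom_S] at this
    simpa using this
  have h2 : E2 (ModularGroup.S • τ) = (τ : ℂ) ^ 2 * E2 τ - 6 * Complex.I / Real.pi * τ := by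
    have h := G2_S_transform τ
    simp only [E2, Pi.smul_apply, smul_eq_mul, riemannZeta_two]
    rw [h]
    field_simp
    ring
  have h4 := hmod (k := 4) E₄
  have h6 := hmod (k := 6) E₆
  ext i
  fin_cases i
  · simp only [eisVal, h2]
    simp
    field_simp
    ring
  · simp only [eisVal, h4]
    simp
    ring
  · simp only [eisVal, h6]
    simp
    ring

theorem eisVal_eq_of_qParam_eq {τ τ' : ℍ} (h : qParam 1 τ = qParam 1 τ') :
    eisVal τ = eisVal τ' := by
  ext i
  simpa using (isQExp_evalG (MvPolynomial.X i)).apply_eq_of_qParam_eq h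

end QExpansions

/-! ### Algebraic independence of `G_2`, `G_4`, `G_6` -/

section AlgebraicIndependence

open UpperHalfPlane Function.Periodic

/-- The point `(t² x + c t, t⁴ y, t⁶ z)`, where `c = i / (4π)`. For `t = τ` this is the value of
`(G_2, G_4, G_6)` at `-1/τ` if `(x, y, z)` is its value at `τ`. -/
noncomputable def twist {A : Type*} [CommRing A] [Algebra ℂ A] (t : A) (v : Fin 3 → A) :
    Fin 3 → A :=
  ![t ^ 2 * v 0 + algebraMap ℂ A (Complex.I / (4 * Real.pi)) * t, t ^ 4 * v 1, t ^ 6 * v 2]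

theorem map_twist {A B : Type*} [CommRing A] [Algebra ℂ A] [CommRing B] [Algebra ℂ B]
    (g : A →ₐ[ℂ] B) (t : A) (v : Fin 3 → A) :
    (fun i => g (twist t v i)) = twist (g t) (fun i => g (v i)) := by
  ext i
  fin_cases i <;> simp [twist]

theorem twist_twist_inv {t : ℂ} (ht : t ≠ 0) (v : Fin 3 → ℂ) :
    twist t (twist t⁻¹ v) = ![v 0 + Complex.I / (2 * Real.pi) * t, v 1, v 2] := by
  have hpi : (Real.pi : ℂ) ≠ 0 := by exact_mod_cast Real.pi_ne_zero
  ext i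
  fin_cases i <;> simp [twist] <;> field_simp
  ring

/-- Since `τ` and `τ + n` have the same `q`, the transformation `τ ↦ -1/τ` applied to all `τ + n`
shows that a relation between `G_2, G_4, G_6` is preserved by `twist t` for infinitely many `t`,
hence for all `t`. -/
theorem aeval_twist_eq_zero {P : MvPolynomial (Fin 3) ℂ} (hP : evalG P = 0) (τ : ℍ) (t : ℂ) :
    MvPolynomial.aeval (twist t (eisVal τ)) P = 0 := by
  let p : Polynomial ℂ := MvPolynomial.aeval
    (twist Polynomial.X (fun i => Polynomial.C (eisVal τ i))) P
  have hp (s : ℂ) : p.eval s = MvPolynomial.aeval (twist s (eisVal τ)) P := by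
    change Polynomial.evalRingHom s p = _
    rw [← Polynomial.coe_aeval_eq_evalRingHom]
    change (Polynomial.aeval s) (MvPolynomial.aeval _ P) = _
    rw [MvPolynomial.comp_aeval_apply, map_twist]
    simp
  have hz (n : ℕ) : p.eval ((τ : ℂ) + n) = 0 := by
    have h1 : eisVal ((n : ℝ) +ᵥ τ) = eisVal τ := by
      refine eisVal_eq_of_qParam_eq ?_
      have h := Complex.exp_periodic.nat_mul n (2 * Real.pi * Complex.I * τ)
      simp only [qParam, coe_vadd]
      rw [Complex.ofReal_one, div_one, div_one, ← h]
      congr 1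
      push_cast
      ring
    have h2 := (evalG_eq_zero_iff P).mp hP (ModularGroup.S • ((n : ℝ) +ᵥ τ))
    rw [eisVal_S, h1] at h2
    rw [hp, ← h2]
    congr 2
    simp [twist, add_comm]
  have h0 : p = 0 := by
    refine Polynomial.eq_zero_of_infinite_isRoot p
      (Set.Infinite.mono ?_ (Set.infinite_range_of_injective
        (f := fun n : ℕ => (τ : ℂ) + n) fun a b h => by simpa using h))
    rintro _ ⟨n, rfl⟩
    exact hz n
  rw [← hp, h0, Polynomial.eval_zero]

theorem aeval_twist_comp (P : MvPolynomial (Fin 3) ℂ) (t : ℂ) (v : Fin 3 → ℂ) :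
    MvPolynomial.aeval v
      (MvPolynomial.aeval (twist (MvPolynomial.C t) MvPolynomial.X) P) =
      MvPolynomial.aeval (twist t v) P := by
  rw [MvPolynomial.comp_aeval_apply, map_twist]
  simp

theorem evalG_twist_eq_zero {P : MvPolynomial (Fin 3) ℂ} (hP : evalG P = 0) (t : ℂ) :
    evalG (MvPolynomial.aeval (twist (MvPolynomial.C t) MvPolynomial.X) P) = 0 := by
  rw [evalG_eq_zero_iff]
  intro τ
  rw [aeval_twist_comp, aeval_twist_eq_zero hP]

/-- Twisting by `t` and by `1/t` translates the first coordinate, so `G_2` may be replaced by an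
arbitrary constant in a relation. -/
theorem aeval_translate_eq_zero {P : MvPolynomial (Fin 3) ℂ} (hP : evalG P = 0) (τ : ℍ) (v : ℂ) :
    MvPolynomial.aeval ![v, eisVal τ 1, eisVal τ 2] P = 0 := by
  have hpi : (Real.pi : ℂ) ≠ 0 := by exact_mod_cast Real.pi_ne_zero
  by_cases hv : v = eisVal τ 0
  · convert (evalG_eq_zero_iff P).mp hP τ using 2
    ext i
    fin_cases i <;> simp [hv]
  · set t : ℂ := (v - eisVal τ 0) * (2 * Real.pi) / Complex.I with ht
    have ht0 : t ≠ 0 := by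
      simp [ht, sub_eq_zero, hv, Real.pi_ne_zero]
    have h := aeval_twist_eq_zero (evalG_twist_eq_zero hP t) τ t⁻¹
    rw [aeval_twist_comp, twist_twist_inv ht0] at h
    convert h using 3
    rw [ht]
    field_simp
    ring_nf

/-- Since `G_2` is free in a relation, twisting by `t` scales `G_4` and `G_6` alone. -/
theorem aeval_scale_eq_zero {P : MvPolynomial (Fin 3) ℂ} (hP : evalG P = 0) (τ : ℍ) (v : ℂ)
    {t : ℂ} (ht : t ≠ 0) :
    MvPolynomial.aeval ![v, t ^ 4 * eisVal τ 1, t ^ 6 * eisVal τ 2] P = 0 := by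
  have h := aeval_translate_eq_zero (evalG_twist_eq_zero hP t) τ
    ((v - Complex.I / (4 * Real.pi) * t) / t ^ 2)
  rw [aeval_twist_comp] at h
  have hpi : (Real.pi : ℂ) ≠ 0 := by exact_mod_cast Real.pi_ne_zero
  convert h using 3
  simp [twist]
  field_simp
  ring

/-- The function `G_6² / G_4³` takes infinitely many values: otherwise a product of factors
`G_6² - r G_4³` would vanish, hence one of them, which the first two coefficients exclude. -/
theorem infinite_ratio :
    (Set.range fun τ : {τ : ℍ // eisVal τ 1 ≠ 0} =>
      eisVal τ.1 2 ^ 2 / eisVal τ.1 1 ^ 3).Infinite := by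
  intro hfin
  let P : MvPolynomial (Fin 3) ℂ := MvPolynomial.X 1 *
    ∏ r ∈ hfin.toFinset, (MvPolynomial.X 2 ^ 2 - MvPolynomial.C r * MvPolynomial.X 1 ^ 3)
  have hP : evalG P = 0 := by
    rw [evalG_eq_zero_iff]
    intro τ
    by_cases h : eisVal τ 1 = 0
    · simp [P, h]
    · simp only [P, map_mul, map_prod]
      refine mul_eq_zero_of_right _ (Finset.prod_eq_zero
        (i := eisVal τ 2 ^ 2 / eisVal τ 1 ^ 3) ?_ ?_)
      · rw [Set.Finite.mem_toFinset]
        exact ⟨⟨τ, h⟩, rfl⟩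
      · simp
        field_simp
        ring
  have c40 : coeff 0 (eisG 4) = 1 / 240 := by
    rw [coeff_eisG (by decide), ← eisConst_four, if_pos rfl]
  have c60 : coeff 0 (eisG 6) = -1 / 504 := by
    rw [coeff_eisG (by decide), ← eisConst_six, if_pos rfl]
  have c41 : coeff 1 (eisG 4) = 1 := by rw [coeff_eisG (by decide)]; simp
  have c61 : coeff 1 (eisG 6) = 1 := by rw [coeff_eisG (by decide)]; simp
  simp only [P, evalG, map_mul, map_prod, mul_eq_zero, Finset.prod_eq_zero_iff] at hP
  rcases hP with hP | ⟨r, -, hP⟩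
  · have := congrArg (coeff 0) hP
    simp only [MvPolynomial.aeval_X] at this
    simp [-coeff_zero_eq_constantCoeff, c40] at this
  · have e0 := congrArg (coeff 0) hP
    have e1 := congrArg (coeff 1) hP
    simp [pow_succ, coeff_mul, Finset.Nat.antidiagonal_succ, -coeff_zero_eq_constantCoeff,
      c40, c60, c41, c61, coeff_C] at e0 e1
    -- `r` occurs as `-r / 240^3` in `e0` and as `-3 r / 240^2` in `e1`; it is eliminated here
    have h : (-1 / 504 + -1 / 504 - 720 * (-1 / 504 * (-1 / 504)) : ℂ) = 0 := by
      linear_combination e1 - 720 * e0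
    norm_num at h

/-- `G_2`, `G_4`, `G_6` are algebraically independent: a relation vanishes at all points
`(v, t⁴ G_4(τ), t⁶ G_6(τ))`, and for given `v 0` and `v 1 ≠ 0` these have infinitely many third
coordinates. -/
theorem evalG_injective : Function.Injective evalG := by
  rw [injective_iff_map_eq_zero]
  intro P hP
  have key (v : Fin 3 → ℂ) (hv : v 1 ≠ 0) : MvPolynomial.aeval v P = 0 := by
    let p : Polynomial ℂ := MvPolynomial.aeval
      ![Polynomial.C (v 0), Polynomial.C (v 1), Polynomial.X] P
    have hp (s : ℂ) : p.eval s = MvPolynomial.aeval ![v 0, v 1, s] P := by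
      change Polynomial.evalRingHom s p = _
      rw [← Polynomial.coe_aeval_eq_evalRingHom]
      change (Polynomial.aeval s) (MvPolynomial.aeval _ P) = _
      rw [MvPolynomial.comp_aeval_apply]
      congr 2
      ext i
      fin_cases i <;> simp
    have h0 : p = 0 := by
      refine Polynomial.eq_zero_of_infinite_isRoot p
        (Set.Infinite.of_image (fun z => z ^ 2 / v 1 ^ 3) (infinite_ratio.mono ?_))
      rintro _ ⟨⟨τ, hτ⟩, rfl⟩
      obtain ⟨t, ht⟩ := IsAlgClosed.exists_pow_nat_eq (v 1 / eisVal τ 1) (n := 4) (by norm_num)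
      have ht0 : t ≠ 0 := by
        rintro rfl
        exact (div_ne_zero hv hτ) (by simpa using ht.symm)
      have ht' : v 1 = t ^ 4 * eisVal τ 1 := by rw [ht]; field_simp
      refine ⟨t ^ 6 * eisVal τ 2, ?_, ?_⟩
      · rw [Set.mem_ofPred_eq, Polynomial.IsRoot, hp, ht']
        exact aeval_scale_eq_zero hP τ (v 0) ht0
      · simp only [ht']
        field_simp
    have h1 := hp (v 2)
    rw [h0, Polynomial.eval_zero] at h1
    convert h1.symm using 2
    ext i
    fin_cases i <;> simp
  have h : MvPolynomial.X 1 * P = 0 := by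
    refine MvPolynomial.funext fun v => ?_
    by_cases hv : v 1 = 0
    · simp [hv]
    · have := key v hv
      rw [MvPolynomial.aeval_eq_eval] at this
      simp [this]
  exact (mul_eq_zero.mp h).resolve_left (MvPolynomial.X_ne_zero 1)

end AlgebraicIndependence

/-! ### Modular forms as polynomials in `G_4` and `G_6` -/

section ModularForms

open UpperHalfPlane ModularForm EisensteinSeries MatrixGroups

theorem exists_modularForm_pow_mul_pow (a b : ℕ) :
    ∃ f : ModularForm 𝒮ℒ ((4 * a + 6 * b : ℕ) : ℤ),
      UpperHalfPlane.qExpansion 1 f = eisG 4 ^ a * eisG 6 ^ b := by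
  refine ⟨ModularForm.mcast (by push_cast; ring)
    ((eisConst 4 ^ a * eisConst 6 ^ b) • (E₄.pow a).mul (E₆.pow b)), ?_⟩
  rw [ModularForm.qExpansion_mcast _ rfl]
  rw [FunLike.coe_smul, ModularForm.qExpansion_smul one_pos one_mem_strictPeriods_SL,
    ModularForm.qExpansion_mul one_pos one_mem_strictPeriods_SL,
    ModularForm.qExpansion_pow one_pos one_mem_strictPeriods_SL,
    ModularForm.qExpansion_pow one_pos one_mem_strictPeriods_SL,
    eisG_eq_smul_qExpansion (k := 4) (by norm_num) (by decide),
    eisG_eq_smul_qExpansion (k := 6) (by norm_num) (by decide), smul_pow, smul_pow,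
    smul_mul_smul_comm]

theorem evalG_monomial (d : Fin 3 →₀ ℕ) (c : ℂ) :
    evalG (MvPolynomial.monomial d c) = c • (eisG 2 ^ d 0 * eisG 4 ^ d 1 * eisG 6 ^ d 2) := by
  rw [evalG, MvPolynomial.aeval_monomial, Finsupp.prod_fintype _ _ (by simp), Fin.prod_univ_three,
    Algebra.smul_def]
  simp

theorem coeff_eq_zero_of_pderiv_eq_zero {P : MvPolynomial (Fin 3) ℂ}
    (h : MvPolynomial.pderiv 0 P = 0) {d : Fin 3 →₀ ℕ} (hd : d 0 ≠ 0) :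
    MvPolynomial.coeff d P = 0 := by
  have h1 := congrArg (MvPolynomial.coeff (d - Finsupp.single 0 1)) h
  rw [MvPolynomial.coeff_pderiv, Finsupp.sub_add_single_one_cancel hd,
    MvPolynomial.coeff_zero] at h1
  exact (mul_eq_zero.mp h1).resolve_right (Nat.cast_add_one_ne_zero _)

/-- A quasimodular form whose polynomial does not involve `G_2` is a modular form. -/
theorem exists_modularForm_of_pderiv_eq_zero {k : ℕ} {P : MvPolynomial (Fin 3) ℂ}
    (hP : P.IsWeightedHomogeneous ![2, 4, 6] k) (h0 : MvPolynomial.pderiv 0 P = 0) :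
    ∃ f : ModularForm 𝒮ℒ (k : ℤ), UpperHalfPlane.qExpansion 1 f = evalG P := by
  rw [P.as_sum, map_sum]
  refine Finset.sum_induction _
    (fun g => ∃ f : ModularForm 𝒮ℒ (k : ℤ), UpperHalfPlane.qExpansion 1 f = g) ?_ ?_ ?_
  · rintro _ _ ⟨f, rfl⟩ ⟨g, rfl⟩
    exact ⟨f + g, ModularForm.qExpansion_add one_pos one_mem_strictPeriods_SL f g⟩
  · exact ⟨0, UpperHalfPlane.qExpansion_zero 1⟩
  · intro d hd
    rw [MvPolynomial.mem_support_iff] at hd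
    have hd0 : d 0 = 0 := by
      by_contra h
      exact hd (coeff_eq_zero_of_pderiv_eq_zero h0 h)
    have hw := hP hd
    rw [Finsupp.weight_apply, Finsupp.sum_fintype _ _ (by simp), Fin.sum_univ_three] at hw
    simp [hd0] at hw
    obtain rfl : 4 * d 1 + 6 * d 2 = k := by omega
    obtain ⟨f, hf⟩ := exists_modularForm_pow_mul_pow (d 1) (d 2)
    refine ⟨MvPolynomial.coeff d P • f, ?_⟩
    rw [FunLike.coe_smul, ModularForm.qExpansion_smul one_pos one_mem_strictPeriods_SL, hf,
      evalG_monomial, hd0]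
    simp

/-- The polynomial in `G_4, G_6` representing the discriminant. -/
noncomputable def discPoly : MvPolynomial (Fin 3) ℂ :=
  MvPolynomial.C (1 / 1728) * (MvPolynomial.C (240 ^ 3) * MvPolynomial.X 1 ^ 3 -
    MvPolynomial.C (504 ^ 2) * MvPolynomial.X 2 ^ 2)

theorem evalG_discPoly : evalG discPoly = UpperHalfPlane.qExpansion 1 discriminant := by
  let F : ModularForm 𝒮ℒ 12 := (1 / 1728 : ℂ) •
    (ModularForm.mcast (by norm_num) (E₄.pow 3) - ModularForm.mcast (by norm_num) (E₆.pow 2))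
  have hF : (F : ℍ → ℂ) = discriminant := by
    ext z
    rw [discriminant_eq_E₄_cube_sub_E₆_sq]
    change (1 / 1728 : ℂ) * (E₄ z ^ 3 - E₆ z ^ 2) = _
    ring
  rw [← hF, FunLike.coe_smul, ModularForm.qExpansion_smul one_pos one_mem_strictPeriods_SL,
    FunLike.coe_sub, ModularForm.qExpansion_sub one_pos one_mem_strictPeriods_SL,
    ModularForm.qExpansion_mcast _ rfl, ModularForm.qExpansion_mcast _ rfl,
    ModularForm.qExpansion_pow one_pos one_mem_strictPeriods_SL,
    ModularForm.qExpansion_pow one_pos one_mem_strictPeriods_SL]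
  simp only [discPoly, evalG, map_mul, map_sub, map_pow, MvPolynomial.aeval_X,
    MvPolynomial.aeval_C, PowerSeries.algebraMap_apply, Algebra.algebraMap_self, RingHom.id_apply]
  simp only [Matrix.cons_val]
  rw [eisG_eq_smul_qExpansion (k := 4) (by norm_num) (by decide),
    eisG_eq_smul_qExpansion (k := 6) (by norm_num) (by decide), eisConst_four, eisConst_six,
    smul_pow, smul_pow, smul_eq_C_mul, smul_eq_C_mul, smul_eq_C_mul, ← mul_assoc, ← mul_assoc,
    ← map_pow, ← map_pow, ← map_mul, ← map_mul]
  norm_num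

theorem isWeightedHomogeneous_discPoly :
    discPoly.IsWeightedHomogeneous ![2, 4, 6] 12 := by
  have h1 := (MvPolynomial.isWeightedHomogeneous_X ℂ (![2, 4, 6] : Fin 3 → ℕ) 1).pow 3
  have h2 := (MvPolynomial.isWeightedHomogeneous_X ℂ (![2, 4, 6] : Fin 3 → ℕ) 2).pow 2
  exact ((h1.C_mul _).sub (h2.C_mul _)).C_mul _

theorem pderiv_zero_discPoly : MvPolynomial.pderiv 0 discPoly = 0 := by
  simp [discPoly, MvPolynomial.pderiv_X]

/-- Level one modular forms are polynomials in `G_4` and `G_6`. The induction subtracts a multiple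
of some `G_4^a G_6^b` to reach a cusp form, and divides it by the discriminant. -/
theorem exists_poly_of_modularForm (k : ℕ) (f : ModularForm 𝒮ℒ (k : ℤ)) :
    ∃ P : MvPolynomial (Fin 3) ℂ, P.IsWeightedHomogeneous ![2, 4, 6] k ∧
      MvPolynomial.pderiv 0 P = 0 ∧ evalG P = UpperHalfPlane.qExpansion 1 f := by
  induction k using Nat.strong_induction_on with
  | _ k ih =>
  have hzero (h : f = 0) : ∃ P : MvPolynomial (Fin 3) ℂ, P.IsWeightedHomogeneous ![2, 4, 6] k ∧
      MvPolynomial.pderiv 0 P = 0 ∧ evalG P = UpperHalfPlane.qExpansion 1 f :=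
    ⟨0, MvPolynomial.isWeightedHomogeneous_zero _ _ _, map_zero _, by
      rw [h, map_zero]; exact (UpperHalfPlane.qExpansion_zero 1).symm⟩
  rcases Nat.even_or_odd k with hk | hk
  swap
  · exact hzero (levelOne_odd_weight_eq_zero (by exact_mod_cast hk) f)
  have hcase : k = 0 ∨ k = 2 ∨ ∃ a b, k = 4 * a + 6 * b := by
    obtain ⟨m, rfl⟩ := hk
    rcases Nat.even_or_odd m with ⟨j, rfl⟩ | ⟨j, rfl⟩
    · exact Or.inr (Or.inr ⟨j, 0, by ring⟩)
    · rcases j with _ | j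
      · simp
      · exact Or.inr (Or.inr ⟨j, 1, by ring⟩)
  rcases hcase with rfl | rfl | ⟨a, b, rfl⟩
  · obtain ⟨c, hc⟩ := ModularFormClass.levelOne_weight_zero_const f
    refine ⟨MvPolynomial.C c, MvPolynomial.isWeightedHomogeneous_C _ _, MvPolynomial.pderiv_C, ?_⟩
    have h := ((isQExp_evalG (MvPolynomial.C c)).add
      ((IsQExp.const (-1)).mul (isQExp_modularForm f))).eq_zero (fun τ => by simp [hc])
    rwa [map_neg, map_one, neg_one_mul, ← sub_eq_add_neg, sub_eq_zero] at h
  · exact hzero (rank_zero_iff_forall_zero.mp levelOne_weight_two_rank_zero f)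
  -- the constant term `e` of `g = G_4^a G_6^b` is nonzero, so `f - c g` is a cusp form
  obtain ⟨g, hg⟩ := exists_modularForm_pow_mul_pow a b
  set e : ℂ := eisConst 4 ^ a * eisConst 6 ^ b with he
  have he0 : e ≠ 0 := mul_ne_zero (pow_ne_zero _ (by rw [eisConst_four]; norm_num))
    (pow_ne_zero _ (by rw [eisConst_six]; norm_num))
  have hg0 : coeff 0 (UpperHalfPlane.qExpansion 1 g) = e := by
    have h4 := coeff_eisG (k := 4) (by decide) 0
    have h6 := coeff_eisG (k := 6) (by decide) 0
    rw [coeff_zero_eq_constantCoeff_apply] at h4 h6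
    simp [hg, h4, h6, he]
  set c : ℂ := coeff 0 (UpperHalfPlane.qExpansion 1 f) / e with hc
  obtain ⟨F, hq⟩ : ∃ F : ModularForm 𝒮ℒ ((4 * a + 6 * b : ℕ) : ℤ),
      UpperHalfPlane.qExpansion 1 F =
        UpperHalfPlane.qExpansion 1 f - c • UpperHalfPlane.qExpansion 1 g := by
    refine ⟨f - c • g, ?_⟩
    rw [FunLike.coe_sub, ModularForm.qExpansion_sub one_pos one_mem_strictPeriods_SL,
      FunLike.coe_smul, ModularForm.qExpansion_smul one_pos one_mem_strictPeriods_SL]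
  have h0 : coeff 0 (UpperHalfPlane.qExpansion 1 F) = 0 := by
    rw [hq, map_sub, map_smul, hg0, hc, smul_eq_mul, div_mul_cancel₀ _ he0, sub_self]
  obtain ⟨Q, hQ1, hQ2, hQ3⟩ : ∃ Q : MvPolynomial (Fin 3) ℂ,
      Q.IsWeightedHomogeneous ![2, 4, 6] (4 * a + 6 * b) ∧ MvPolynomial.pderiv 0 Q = 0 ∧
      evalG Q = UpperHalfPlane.qExpansion 1 F := by
    obtain ⟨h, hfac⟩ : ∃ h : ModularForm 𝒮ℒ (((4 * a + 6 * b : ℕ) : ℤ) - 12),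
        UpperHalfPlane.qExpansion 1 F =
          UpperHalfPlane.qExpansion 1 discriminant * UpperHalfPlane.qExpansion 1 h :=
      ⟨_, qExpansion_eq_qExpansion_discriminant_mul F h0⟩
    rcases lt_or_ge (4 * a + 6 * b) 12 with hlt | hge
    · refine ⟨0, MvPolynomial.isWeightedHomogeneous_zero _ _ _, map_zero _, ?_⟩
      rw [hfac, ModularFormClass.levelOne_neg_weight_eq_zero (by omega) h,
        UpperHalfPlane.qExpansion_zero, mul_zero, map_zero]
    · obtain ⟨R, hR1, hR2, hR3⟩ := ih (4 * a + 6 * b - 12) (by omega)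
        (ModularForm.mcast (by omega) h)
      refine ⟨discPoly * R, ?_, ?_, ?_⟩
      · have := isWeightedHomogeneous_discPoly.mul hR1
        rwa [Nat.add_sub_cancel' hge] at this
      · rw [MvPolynomial.pderiv_mul, pderiv_zero_discPoly, hR2]
        simp
      · rw [map_mul, evalG_discPoly, hR3, hfac, ModularForm.qExpansion_mcast _ rfl]
  have hmon : evalG (MvPolynomial.X 1 ^ a * MvPolynomial.X 2 ^ b) =
      UpperHalfPlane.qExpansion 1 g := by
    rw [hg]
    simp [evalG]
  refine ⟨Q + MvPolynomial.C c * (MvPolynomial.X 1 ^ a * MvPolynomial.X 2 ^ b),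
    hQ1.add (.C_mul ?_ _), ?_, ?_⟩
  · have h1 := (MvPolynomial.isWeightedHomogeneous_X ℂ (![2, 4, 6] : Fin 3 → ℕ) 1).pow a
    have h2 := (MvPolynomial.isWeightedHomogeneous_X ℂ (![2, 4, 6] : Fin 3 → ℕ) 2).pow b
    convert h1.mul h2 using 1
    simp
    ring
  · simp [hQ2, MvPolynomial.pderiv_X]
  · rw [map_add, hQ3, map_mul, hmon, hq, smul_eq_C_mul]
    simp [evalG]

end ModularForms

/-! ### Half-integral powers as binomial sums -/

section BinomialExpansion

variable {A : Type*} [CommRing A] [Algebra ℚ A]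

theorem coeff_pow_eq_zero_of_lt {R : Type*} [CommSemiring R] {u : R⟦X⟧}
    (hu : constantCoeff u = 0) {n j : ℕ} (h : n < j) : coeff n (u ^ j) = 0 :=
  coeff_of_lt_order _ ((Nat.cast_lt.mpr h).trans_le (le_order_pow_of_constantCoeff_eq_zero j hu))

theorem constantCoeff_binomialSeries_subst {u : A⟦X⟧} (hu : constantCoeff u = 0) (r : ℚ) :
    constantCoeff ((binomialSeries A r).subst u) = 1 := by
  rw [← coeff_zero_eq_constantCoeff_apply,
    PowerSeries.coeff_subst' (PowerSeries.HasSubst.of_constantCoeff_zero' hu),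
    finsum_eq_single _ 0]
  · simp
  · intro n hn
    simp [hu, hn]

theorem binomialSeries_subst_half_sq {u : A⟦X⟧} (hu : constantCoeff u = 0) :
    (binomialSeries A (1 / 2 : ℚ)).subst u ^ 2 = 1 + u := by
  have hs := PowerSeries.HasSubst.of_constantCoeff_zero' hu
  have h : (binomialSeries A (1 / 2 : ℚ)) ^ 2 = 1 + X := by
    rw [sq, ← binomialSeries_add]
    have := binomialSeries_nat (R := ℚ) (A := A) 1
    norm_num at this ⊢
    exact this
  rw [← PowerSeries.subst_pow hs, h, PowerSeries.subst_add hs, PowerSeries.subst_X hs,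
    ← PowerSeries.coe_substAlgHom hs, map_one]

/-- A square root of a power series is determined by its constant term. -/
theorem eq_of_sq_eq_sq_of_constantCoeff [IsDomain A] {V W : A⟦X⟧} (h : V ^ 2 = W ^ 2)
    (hV : constantCoeff V = 1) (hW : constantCoeff W = 1) : V = W := by
  rcases sq_eq_sq_iff_eq_or_eq_neg.mp h with h | h
  · exact h
  · have h1 := congrArg constantCoeff h
    rw [map_neg, hV, hW, eq_neg_iff_add_eq_zero, one_add_one_eq_two] at h1
    have : CharZero A := algebraRat.charZero A
    exact absurd h1 two_ne_zero

/-- The expansion of `(1 + u)^(k + 1/2)`, for any square root `V` of `1 + u`. -/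
theorem coeff_sqrt_pow [IsDomain A] {u V : A⟦X⟧} (hV : V ^ 2 = 1 + u) (hV0 : constantCoeff V = 1)
    (hu : constantCoeff u = 0) (n k : ℕ) :
    coeff n (V ^ (2 * k + 1)) =
      ∑ j ∈ Finset.range (n + 1), Ring.choose ((k : ℚ) + 1 / 2) j • coeff n (u ^ j) := by
  have hs := PowerSeries.HasSubst.of_constantCoeff_zero' hu
  have hVB : V = (binomialSeries A (1 / 2 : ℚ)).subst u :=
    eq_of_sq_eq_sq_of_constantCoeff (by rw [hV, binomialSeries_subst_half_sq hu]) hV0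
      (constantCoeff_binomialSeries_subst hu _)
  have hk : (1 + u) ^ k = (binomialSeries A (k : ℚ)).subst u := by
    rw [binomialSeries_nat, PowerSeries.subst_pow hs, PowerSeries.subst_add hs,
      PowerSeries.subst_X hs, ← PowerSeries.coe_substAlgHom hs, map_one]
  rw [pow_succ, pow_mul, hV, hk, hVB, ← PowerSeries.subst_mul hs, ← binomialSeries_add,
    PowerSeries.coeff_subst' hs, finsum_eq_sum_of_support_subset (s := Finset.range (n + 1))]
  · refine Finset.sum_congr rfl fun j _ => ?_
    rw [binomialSeries_coeff, smul_assoc, one_smul]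
  · intro j hj
    rw [Function.mem_support] at hj
    rw [Finset.mem_coe, Finset.mem_range]
    by_contra hlt
    refine hj ?_
    rw [coeff_pow_eq_zero_of_lt hu (by omega), smul_zero]

end BinomialExpansion

section Residue

/-- The power series `u = z² (℘ - 4 G_2) - 1`. -/
noncomputable def wpArg : ℂ⟦X⟧⟦X⟧ := X ^ 2 * (wpRegular - C (4 * eisG 2))

/-- The power series `z (℘ - 4 G_2)^(1/2)`. -/
noncomputable def sqrtRegular : ℂ⟦X⟧⟦X⟧ := (binomialSeries ℂ⟦X⟧ (1 / 2 : ℚ)).subst wpArg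

theorem constantCoeff_wpArg : constantCoeff wpArg = 0 := by
  simp [wpArg]

theorem sqrtRegular_sq : sqrtRegular ^ 2 = 1 + wpArg :=
  binomialSeries_subst_half_sq constantCoeff_wpArg

theorem constantCoeff_sqrtRegular : constantCoeff sqrtRegular = 1 :=
  constantCoeff_binomialSeries_subst constantCoeff_wpArg _

theorem seriesA_eq (k : ℕ) : seriesA k =
    ((-1 : ℂ) ^ k / ((2 * k + 1)‼ : ℂ)) • coeff (2 * k) (sqrtRegular ^ (2 * k + 1)) := by
  rw [seriesA, ← sqrtWpShift_sq, ← pow_mul, ← pow_succ]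
  congr 1
  have h : sqrtWpShift =
      HahnSeries.single (-1 : ℤ) 1 * HahnSeries.ofPowerSeries ℤ ℂ⟦X⟧ sqrtRegular := rfl
  rw [h, mul_pow, HahnSeries.single_pow, one_pow, ← map_pow]
  have h2 := HahnSeries.coeff_single_mul_add (r := (1 : ℂ⟦X⟧)) (b := (2 * k + 1) • (-1 : ℤ))
    (a := ((2 * k : ℕ) : ℤ)) (x := HahnSeries.ofPowerSeries ℤ ℂ⟦X⟧ (sqrtRegular ^ (2 * k + 1)))
  rw [one_mul, HahnSeries.ofPowerSeries_apply_coeff] at h2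
  rw [← h2]
  congr 1
  simp

theorem seriesA_eq_sum (k : ℕ) : seriesA k = ((-1 : ℂ) ^ k / ((2 * k + 1)‼ : ℂ)) •
    ∑ j ∈ Finset.range (2 * k + 1),
      Ring.choose ((k : ℚ) + 1 / 2) j • coeff (2 * k) (wpArg ^ j) := by
  rw [seriesA_eq, coeff_sqrt_pow sqrtRegular_sq constantCoeff_sqrtRegular constantCoeff_wpArg]

end Residue

/-! ### Quasimodularity and the derivative along `G_2` -/

section Quasimodular

theorem exists_poly_eisG {k : ℕ} (hk : 3 ≤ k) :
    ∃ P : MvPolynomial (Fin 3) ℂ, P.IsWeightedHomogeneous ![2, 4, 6] k ∧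
      MvPolynomial.pderiv 0 P = 0 ∧ evalG P = eisG k := by
  rcases Nat.even_or_odd k with hk2 | hk2
  · obtain ⟨P, h1, h2, h3⟩ := exists_poly_of_modularForm k (ModularForm.E hk)
    refine ⟨MvPolynomial.C (eisConst k) * P, h1.C_mul _, by simp [h2], ?_⟩
    rw [map_mul, h3, eisG_eq_smul_qExpansion hk hk2, smul_eq_C_mul]
    simp [evalG]
  · exact ⟨0, MvPolynomial.isWeightedHomogeneous_zero _ _ _, map_zero _, by
      rw [eisG_of_odd hk2, map_zero]⟩

/-- A polynomial in `G_4, G_6` that represents `G_k`, for `k ≥ 3`; the value is `0` for `k ≤ 2`. -/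
noncomputable def eisPoly (k : ℕ) : MvPolynomial (Fin 3) ℂ :=
  if hk : 3 ≤ k then (exists_poly_eisG hk).choose else 0

theorem eisPoly_spec {k : ℕ} (hk : 3 ≤ k) : (eisPoly k).IsWeightedHomogeneous ![2, 4, 6] k ∧
    MvPolynomial.pderiv 0 (eisPoly k) = 0 ∧ evalG (eisPoly k) = eisG k := by
  rw [eisPoly, dif_pos hk]
  exact (exists_poly_eisG hk).choose_spec

/-- The lift of `wpArg` to a power series over the polynomial ring in `G_2, G_4, G_6`. -/
noncomputable def wpArgPoly : (MvPolynomial (Fin 3) ℂ)⟦X⟧ :=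
  PowerSeries.mk fun m => if 4 ≤ m then (2 / ((m - 2)! : ℂ)) • eisPoly m
    else if m = 2 then -4 * MvPolynomial.X 0 else 0

theorem constantCoeff_wpArgPoly : constantCoeff wpArgPoly = 0 := by
  simp [wpArgPoly, ← coeff_zero_eq_constantCoeff_apply]

theorem map_evalG_wpArgPoly :
    PowerSeries.map (evalG : MvPolynomial (Fin 3) ℂ →+* ℂ⟦X⟧) wpArgPoly = wpArg := by
  ext1 m
  rw [coeff_map, wpArgPoly, coeff_mk, wpArg, coeff_X_pow_mul']
  rcases m with _ | _ | m
  · simp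
  · simp
  · simp only [wpRegular, map_sub, coeff_mk, coeff_C]
    rcases m with _ | _ | m
    · simp [evalG]
    · simp
    · simp [(eisPoly_spec (show 3 ≤ m + 1 + 1 + 1 + 1 by omega)).2.2]

theorem isWeightedHomogeneous_coeff_wpArgPoly (m : ℕ) :
    (coeff m wpArgPoly).IsWeightedHomogeneous ![2, 4, 6] m := by
  rw [wpArgPoly, coeff_mk]
  split_ifs with h1 h2
  · rw [MvPolynomial.smul_eq_C_mul]
    exact (eisPoly_spec (by omega)).1.C_mul _
  · subst h2
    have h := (MvPolynomial.isWeightedHomogeneous_X ℂ (![2, 4, 6] : Fin 3 → ℕ) 0).C_mul (-4)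
    rw [map_neg, map_ofNat] at h
    exact h
  · exact MvPolynomial.isWeightedHomogeneous_zero _ _ _

theorem isWeightedHomogeneous_coeff_wpArgPoly_pow (j m : ℕ) :
    (coeff m (wpArgPoly ^ j)).IsWeightedHomogeneous ![2, 4, 6] m := by
  induction j generalizing m with
  | zero =>
    rw [pow_zero, coeff_one]
    split_ifs with h
    · rw [h]; exact MvPolynomial.isWeightedHomogeneous_one _ _
    · exact MvPolynomial.isWeightedHomogeneous_zero _ _ _
  | succ j ih =>
    rw [pow_succ, coeff_mul]
    refine MvPolynomial.IsWeightedHomogeneous.sum _ _ _ fun p hp => ?_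
    rw [← Finset.HasAntidiagonal.mem_antidiagonal.mp hp]
    exact (ih _).mul (isWeightedHomogeneous_coeff_wpArgPoly _)

/-- The derivative with respect to `G_2`, coefficient by coefficient. -/
noncomputable def coeffDeriv (f : (MvPolynomial (Fin 3) ℂ)⟦X⟧) : (MvPolynomial (Fin 3) ℂ)⟦X⟧ :=
  PowerSeries.mk fun m => MvPolynomial.pderiv 0 (coeff m f)

theorem coeffDeriv_mul (f g : (MvPolynomial (Fin 3) ℂ)⟦X⟧) :
    coeffDeriv (f * g) = coeffDeriv f * g + f * coeffDeriv g := by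
  ext1 m
  simp only [coeffDeriv, coeff_mk, map_add, coeff_mul, map_sum, MvPolynomial.pderiv_mul,
    Finset.sum_add_distrib]

theorem coeffDeriv_wpArgPoly : coeffDeriv wpArgPoly = -4 * X ^ 2 := by
  have h : (-4 * X ^ 2 : (MvPolynomial (Fin 3) ℂ)⟦X⟧) = C (-4) * X ^ 2 := by
    rw [map_neg]; rfl
  ext1 m
  rw [h, coeff_C_mul_X_pow, coeffDeriv, coeff_mk, wpArgPoly, coeff_mk]
  split_ifs with h1 h2 h2
  · omega
  · rw [Derivation.map_smul, (eisPoly_spec (by omega)).2.1, smul_zero]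
  · rw [← map_ofNat MvPolynomial.C 4, ← map_neg, MvPolynomial.pderiv_C_mul,
      MvPolynomial.pderiv_X_self, mul_one, map_neg, map_ofNat]
  · simp

theorem coeffDeriv_wpArgPoly_pow (j : ℕ) :
    coeffDeriv (wpArgPoly ^ (j + 1)) =
      (-4 * (j + 1) : (MvPolynomial (Fin 3) ℂ)⟦X⟧) * X ^ 2 * wpArgPoly ^ j := by
  induction j with
  | zero =>
    rw [zero_add, pow_one, coeffDeriv_wpArgPoly]
    simp
  | succ j ih =>
    rw [pow_succ, coeffDeriv_mul, ih, coeffDeriv_wpArgPoly]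
    push_cast
    ring

theorem pderiv_coeff_wpArgPoly_pow (j m : ℕ) :
    MvPolynomial.pderiv 0 (coeff (m + 2) (wpArgPoly ^ (j + 1))) =
      (-4 * (j + 1) : ℚ) • coeff m (wpArgPoly ^ j) := by
  have h := congrArg (coeff (m + 2)) (coeffDeriv_wpArgPoly_pow j)
  rw [coeffDeriv, coeff_mk] at h
  rw [h]
  have h2 : (-4 * (j + 1) : (MvPolynomial (Fin 3) ℂ)⟦X⟧) * X ^ 2 * wpArgPoly ^ j =
      X ^ 2 * ((-4 * (j + 1) : ℚ) • wpArgPoly ^ j) := by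
    rw [Algebra.smul_def]
    simp only [map_neg, map_mul, map_add, map_natCast, map_one, map_ofNat]
    ring
  rw [h2, coeff_X_pow_mul]
  simp

/-- The polynomial in `G_2, G_4, G_6` that represents `seriesA k`. -/
noncomputable def polyA (k : ℕ) : MvPolynomial (Fin 3) ℂ :=
  ((-1 : ℂ) ^ k / ((2 * k + 1)‼ : ℂ)) •
    ∑ j ∈ Finset.range (2 * k + 1), Ring.choose ((k : ℚ) + 1 / 2) j • coeff (2 * k) (wpArgPoly ^ j)

theorem evalG_polyA (k : ℕ) : evalG (polyA k) = seriesA k := by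
  rw [polyA, seriesA_eq_sum, map_smul, map_sum]
  congr 1
  refine Finset.sum_congr rfl fun j _ => ?_
  rw [← map_evalG_wpArgPoly, ← map_pow, coeff_map]
  exact map_rat_smul _ _ _

theorem isWeightedHomogeneous_polyA (k : ℕ) :
    (polyA k).IsWeightedHomogeneous ![2, 4, 6] (2 * k) := by
  have hsmul (c : ℂ) {P : MvPolynomial (Fin 3) ℂ} {m : ℕ}
      (h : P.IsWeightedHomogeneous ![2, 4, 6] m) : (c • P).IsWeightedHomogeneous ![2, 4, 6] m := by
    rw [MvPolynomial.smul_eq_C_mul]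
    exact h.C_mul c
  refine hsmul _ (MvPolynomial.IsWeightedHomogeneous.sum _ _ _ fun j _ => ?_)
  rw [← Rat.cast_smul_eq_qsmul ℂ]
  exact hsmul _ (isWeightedHomogeneous_coeff_wpArgPoly_pow _ _)

theorem choose_eq_eval_descPochhammer (r : ℚ) (n : ℕ) :
    Ring.choose r n = (descPochhammer ℚ n).eval r / n ! := by
  have h := Ring.descPochhammer_eq_factorial_smul_choose r n
  rw [← Polynomial.aeval_eq_smeval, Polynomial.aeval_def, ← Polynomial.eval_map,
    descPochhammer_map, nsmul_eq_mul] at h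
  rw [h, mul_div_cancel_left₀]
  exact_mod_cast n.factorial_ne_zero

/-- The absorption identity `(j + 1) binom(k + 3/2, j + 1) = (k + 3/2) binom(k + 1/2, j)`. -/
theorem choose_succ_mul (k j : ℕ) :
    Ring.choose (((k + 1 : ℕ) : ℚ) + 1 / 2) (j + 1) * (j + 1) =
      ((k : ℚ) + 3 / 2) * Ring.choose ((k : ℚ) + 1 / 2) j := by
  have h : ((j ! : ℕ) : ℚ) ≠ 0 := by exact_mod_cast j.factorial_ne_zero
  have h1 : (j : ℚ) + 1 ≠ 0 := by exact_mod_cast j.succ_ne_zero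
  have h2 : ((k + 1 : ℕ) : ℚ) + 1 / 2 - 1 = (k : ℚ) + 1 / 2 := by push_cast; ring
  rw [choose_eq_eval_descPochhammer, choose_eq_eval_descPochhammer, descPochhammer_succ_left,
    Polynomial.eval_mul, Polynomial.eval_X, Polynomial.eval_comp, Polynomial.eval_sub,
    Polynomial.eval_X, Polynomial.eval_one, h2, Nat.factorial_succ]
  push_cast
  field_simp
  ring

theorem pderiv_polyA_zero : MvPolynomial.pderiv 0 (polyA 0) = 0 := by
  simp [polyA]

/-- Differentiating the expansion of `(1 + u)^(k + 3/2)` termwise, with `du/dG_2 = -4 z²`, gives the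
factor `-4 (k + 3/2) = -2 (2k + 3)`, which the double factorial turns into `2`. -/
theorem pderiv_polyA_succ (k : ℕ) :
    MvPolynomial.pderiv 0 (polyA (k + 1)) = 2 * polyA k := by
  have hsum : MvPolynomial.pderiv 0 (∑ j ∈ Finset.range (2 * (k + 1) + 1),
      Ring.choose (((k + 1 : ℕ) : ℚ) + 1 / 2) j • coeff (2 * (k + 1)) (wpArgPoly ^ j)) =
      (-4 * ((k : ℚ) + 3 / 2)) • ∑ j ∈ Finset.range (2 * k + 1),
        Ring.choose ((k : ℚ) + 1 / 2) j • coeff (2 * k) (wpArgPoly ^ j) := by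
    -- with an additional zero term, the sum for `k` matches the sum for `k + 1` without `j = 0`
    have hlast : coeff (2 * k) (wpArgPoly ^ (2 * k + 1)) = 0 :=
      coeff_pow_eq_zero_of_lt constantCoeff_wpArgPoly (by omega)
    have hext : ∑ j ∈ Finset.range (2 * k + 1),
        Ring.choose ((k : ℚ) + 1 / 2) j • coeff (2 * k) (wpArgPoly ^ j) =
        ∑ j ∈ Finset.range (2 * k + 1 + 1),
        Ring.choose ((k : ℚ) + 1 / 2) j • coeff (2 * k) (wpArgPoly ^ j) := by
      rw [Finset.sum_range_succ _ (2 * k + 1), hlast, smul_zero, add_zero]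
    have hq (q : ℚ) (P : MvPolynomial (Fin 3) ℂ) :
        MvPolynomial.pderiv 0 (q • P) = q • MvPolynomial.pderiv 0 P :=
      map_rat_smul _ _ _
    rw [hext, map_sum, show 2 * (k + 1) + 1 = 2 * k + 1 + 1 + 1 by ring, Finset.sum_range_succ',
      Finset.smul_sum]
    have h0 : MvPolynomial.pderiv 0 (Ring.choose (((k + 1 : ℕ) : ℚ) + 1 / 2) 0 •
        coeff (2 * (k + 1)) (wpArgPoly ^ 0)) = 0 := by
      simp [coeff_one]
    rw [h0, add_zero]
    refine Finset.sum_congr rfl fun j _ => ?_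
    rw [hq, show 2 * (k + 1) = 2 * k + 2 by ring, pderiv_coeff_wpArgPoly_pow, smul_smul, smul_smul]
    congr 1
    linear_combination (-4) * choose_succ_mul k j
  have hk : (2 * (k : ℂ) + 3) ≠ 0 := by exact_mod_cast (show 2 * k + 3 ≠ 0 by omega)
  have hdf : (((2 * k + 1)‼ : ℕ) : ℂ) ≠ 0 := by exact_mod_cast (Nat.doubleFactorial_pos _).ne'
  rw [polyA, Derivation.map_smul, hsum, polyA, ← Rat.cast_smul_eq_qsmul ℂ, smul_smul,
    ← map_ofNat MvPolynomial.C 2, ← MvPolynomial.smul_eq_C_mul, smul_smul]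
  congr 1
  rw [show 2 * (k + 1) + 1 = 2 * k + 1 + 2 by ring, Nat.doubleFactorial_add_two]
  push_cast
  rw [show (2 * (k : ℂ) + 1 + 2) = 2 * k + 3 by ring]
  field_simp
  ring

/-- By algebraic independence, the derivative along `G_2` may be computed from one representing
polynomial. -/
theorem hasDerivG2_iff (P : MvPolynomial (Fin 3) ℂ) (g : ℂ⟦X⟧) :
    HasDerivG2 (evalG P) g ↔ evalG (MvPolynomial.pderiv 0 P) = g := by
  refine ⟨fun h => h.2 P rfl, fun h => ⟨⟨P, rfl⟩, fun Q hQ => ?_⟩⟩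
  rw [evalG_injective hQ, h]

end Quasimodular

/-! ### The hyperbolic cotangent and its residues -/

section Coth

/-- The power series `(z / 2) coth (z / 2)`. -/
noncomputable def zCoth : ℂ⟦X⟧ := bernoulliPowerSeries ℂ + C (1 / 2) * X

/-- The power series `exp (-z)`. -/
noncomputable def expNeg : ℂ⟦X⟧ := evalNegHom (exp ℂ)

/-- The power series `cosh² (z / 2)`. -/
noncomputable def coshSq : ℂ⟦X⟧ := C (1 / 4) * (exp ℂ + expNeg + 2)

theorem four_mul_coshSq : 4 * coshSq = exp ℂ + expNeg + 2 := by
  rw [coshSq, ← mul_assoc, ← map_ofNat C 4, ← map_mul]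
  norm_num

theorem exp_mul_expNeg : exp ℂ * expNeg = 1 := exp_mul_exp_neg_eq_one

theorem exp_sub_one_ne_zero : exp ℂ - 1 ≠ 0 := by
  intro h
  have := congrArg (coeff 1) h
  simp [coeff_exp, coeff_one] at this

theorem coeff_zCoth (m : ℕ) :
    coeff m zCoth = if Even m then ((bernoulli m : ℚ) : ℂ) / m ! else 0 := by
  rw [zCoth, bernoulliPowerSeries, map_add, coeff_mk, coeff_C_mul, coeff_X]
  rcases Nat.even_or_odd m with hm | hm
  · have h1 : m ≠ 1 := by rintro rfl; simp at hm
    simp [hm, h1]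
  · rw [if_neg (Nat.not_even_iff_odd.mpr hm)]
    by_cases h1 : m = 1
    · subst h1
      norm_num [bernoulli_one]
    · have : bernoulli m = 0 := bernoulli_eq_zero_of_odd hm (by obtain ⟨j, rfl⟩ := hm; omega)
      simp [this, h1]

theorem constantCoeff_zCoth : constantCoeff zCoth = 1 := by
  rw [← coeff_zero_eq_constantCoeff_apply, coeff_zCoth]
  simp

theorem zCoth_mul_exp_sub_one : 2 * zCoth * (exp ℂ - 1) = X * (exp ℂ + 1) := by
  have h := bernoulliPowerSeries_mul_exp_sub_one ℂ
  have h2 : (2 : ℂ⟦X⟧) * C (1 / 2) = 1 := by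
    rw [← map_ofNat C 2, ← map_mul]
    norm_num
  rw [zCoth]
  linear_combination 2 * h + (X * (exp ℂ - 1)) * h2

/-- The differential equation `y' = 1/4 - y²` of `y = coth (z / 2) / 2`, written for
`z y`. -/
theorem X_mul_deriv_zCoth :
    4 * (X * d⁄dX ℂ zCoth) = 4 * zCoth - 4 * zCoth ^ 2 + X ^ 2 := by
  have h := zCoth_mul_exp_sub_one
  have h' := congrArg (d⁄dX ℂ) h
  simp only [Derivation.leibniz, map_add, map_sub, derivative_exp, smul_eq_mul, derivative_X,
    Derivation.map_one_eq_zero, show d⁄dX ℂ (2 : ℂ⟦X⟧) = 0 from Derivation.map_natCast _ 2] at h'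
  refine mul_right_cancel₀ (pow_ne_zero 2 exp_sub_one_ne_zero) ?_
  linear_combination (2 * X * (exp ℂ - 1)) * h' + (-2 * X * exp ℂ - 2 * (exp ℂ - 1) +
    2 * zCoth * (exp ℂ - 1) + X * (exp ℂ + 1)) * h

/-- The identity `cosh² (z / 2) = y² / (y² - 1/4)` for `y = coth (z / 2) / 2`. -/
theorem coshSq_mul : coshSq * (4 * zCoth ^ 2 - X ^ 2) = 4 * zCoth ^ 2 := by
  have h := zCoth_mul_exp_sub_one
  have h4 := four_mul_coshSq
  have he := exp_mul_expNeg
  have h40 : (4 : ℂ⟦X⟧) ≠ 0 := by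
    rw [← map_ofNat C 4, Ne, map_eq_zero_iff C C_injective]
    norm_num
  refine mul_left_cancel₀ (mul_ne_zero h40 (pow_ne_zero 2 exp_sub_one_ne_zero)) ?_
  linear_combination (4 * coshSq - 4) * (2 * zCoth * (exp ℂ - 1) + X * (exp ℂ + 1)) * h +
    4 * X ^ 2 * exp ℂ * h4 + 4 * X ^ 2 * he

theorem constantCoeff_coshSq : constantCoeff coshSq = 1 := by
  have h : constantCoeff expNeg = 1 := by
    rw [expNeg, evalNegHom, ← coeff_zero_eq_constantCoeff_apply, coeff_rescale]
    simp
  rw [coshSq, map_mul, map_add, map_add, h, map_ofNat]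
  norm_num

/-- The residue of `y^m` for `y = coth (z / 2) / 2` is a quarter of that of `y^(m-2)` for
`m ≥ 3`: by the differential equation `4 y^m - y^(m-2)` is a derivative. -/
theorem four_mul_coeff_zCoth_pow (m : ℕ) :
    4 * coeff (m + 2) (zCoth ^ (m + 3)) = coeff m (zCoth ^ (m + 1)) := by
  have h := congrArg (fun f => coeff (m + 2) (zCoth ^ (m + 1) * f)) X_mul_deriv_zCoth
  have hd : ((m + 2 : ℕ) : ℂ⟦X⟧) * (zCoth ^ (m + 1) * (X * d⁄dX ℂ zCoth)) =
      X * d⁄dX ℂ (zCoth ^ (m + 2)) := by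
    rw [Derivation.leibniz_pow]
    simp
    ring
  have hd2 := congrArg (coeff (m + 2)) hd
  rw [coeff_succ_X_mul, coeff_derivative, ← map_natCast C, coeff_C_mul] at hd2
  have hm : ((m + 2 : ℕ) : ℂ) ≠ 0 := by exact_mod_cast Nat.succ_ne_zero (m + 1)
  have hd3 : coeff (m + 2) (zCoth ^ (m + 1) * (X * d⁄dX ℂ zCoth)) =
      coeff (m + 2) (zCoth ^ (m + 2)) := by
    refine mul_left_cancel₀ hm (hd2.trans ?_)
    push_cast
    ring
  have e1 : zCoth ^ (m + 1) * (4 * (X * d⁄dX ℂ zCoth)) =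
      C 4 * (zCoth ^ (m + 1) * (X * d⁄dX ℂ zCoth)) := by rw [map_ofNat]; ring
  have e2 : zCoth ^ (m + 1) * (4 * zCoth - 4 * zCoth ^ 2 + X ^ 2) =
      C 4 * zCoth ^ (m + 2) - C 4 * zCoth ^ (m + 3) + X ^ 2 * zCoth ^ (m + 1) := by
    rw [map_ofNat]; ring
  simp only [e1, e2, map_add, map_sub, coeff_C_mul, hd3, coeff_X_pow_mul] at h
  linear_combination h

/-- The residue of `y^(2r+1) cosh² (z/2)^i` for `y = coth (z/2) / 2`. -/
theorem coeff_zCoth_pow_mul_coshSq_pow (i r : ℕ) :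
    4 ^ r * coeff (2 * r) (zCoth ^ (2 * r + 1) * coshSq ^ i) = (r + i).choose i := by
  induction i generalizing r with
  | zero =>
    induction r with
    | zero => simp [constantCoeff_zCoth]
    | succ r ih =>
      have h := four_mul_coeff_zCoth_pow (2 * r)
      rw [pow_zero, mul_one] at ih ⊢
      rw [show 2 * (r + 1) = 2 * r + 2 by ring, pow_succ, mul_assoc, h]
      simpa using ih
  | succ i ihi =>
    induction r with
    | zero => simp [constantCoeff_zCoth, constantCoeff_coshSq]
    | succ r ihr =>
      have h : 4 * (zCoth ^ (2 * r + 3) * coshSq ^ (i + 1)) =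
          X ^ 2 * (zCoth ^ (2 * r + 1) * coshSq ^ (i + 1)) +
          4 * (zCoth ^ (2 * r + 3) * coshSq ^ i) := by
        linear_combination (zCoth ^ (2 * r + 1) * coshSq ^ i) * coshSq_mul
      have h2 := congrArg (coeff (2 * r + 2)) h
      rw [← map_ofNat C 4, map_add, coeff_C_mul, coeff_C_mul, coeff_X_pow_mul] at h2
      have h3 := ihi (r + 1)
      rw [show 2 * (r + 1) = 2 * r + 2 by ring] at h3 ⊢
      rw [pow_succ] at h3 ⊢
      rw [show r + 1 + (i + 1) = r + 1 + i + 1 by ring, Nat.choose_succ_succ]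
      push_cast
      rw [← h3, show r + 1 + i = r + (i + 1) by ring, ← ihr]
      linear_combination 4 ^ r * h2

theorem coeff_zCoth_pow_mul_aeval {n : ℕ} {Q : Polynomial ℂ} (hQ : Q.natDegree ≤ n) (r : ℕ) :
    4 ^ r * coeff (2 * r) (zCoth ^ (2 * r + 1) * Polynomial.aeval coshSq Q) =
      ∑ i ∈ Finset.range (n + 1), Q.coeff i * (r + i).choose i := by
  rw [Polynomial.aeval_eq_sum_range' (Nat.lt_succ_of_le hQ), Finset.mul_sum, map_sum,
    Finset.mul_sum]
  refine Finset.sum_congr rfl fun i _ => ?_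
  rw [← coeff_zCoth_pow_mul_coshSq_pow, mul_smul_comm, map_smul, smul_eq_mul]
  ring

end Coth

/-! ### The Weierstrass function as a power series in `q` -/

section Swap

/-- The exchange of the two variables of a power series in `z` over power series in `q`. -/
noncomputable def swapVars : ℂ⟦X⟧⟦X⟧ →+* ℂ⟦X⟧⟦X⟧ where
  toFun F := PowerSeries.mk fun n => PowerSeries.mk fun m => coeff n (coeff m F)
  map_zero' := by ext; simp
  map_one' := by
    ext n m
    simp only [coeff_mk, coeff_one]
    split_ifs <;> simp_all [coeff_one]
  map_add' F G := by ext; simp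
  map_mul' F G := by
    ext n m
    simp only [coeff_mk, coeff_mul, map_sum]
    exact Finset.sum_comm

@[simp]
theorem coeff_coeff_swapVars (F : ℂ⟦X⟧⟦X⟧) (m n : ℕ) :
    coeff m (coeff n (swapVars F)) = coeff n (coeff m F) := by
  simp [swapVars]

/-- The coefficient `∑_{d ∣ n} d (w^d + w^(-d) - 6)`, `w = exp z`, of `q^n` in `℘ - 4 G_2`
for `n ≥ 1`. -/
noncomputable def wpCoeff (n : ℕ) : ℂ⟦X⟧ :=
  ∑ d ∈ n.divisors, C (d : ℂ) * (exp ℂ ^ d + expNeg ^ d - 6)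

/-- The part of `℘ - 4 G_2` of positive degree in `q`. -/
noncomputable def wpTail : ℂ⟦X⟧⟦X⟧ := PowerSeries.mk wpCoeff

theorem constantCoeff_wpTail : constantCoeff wpTail = 0 := by
  rw [← coeff_zero_eq_constantCoeff_apply]
  simp [wpTail, wpCoeff]

theorem coeff_exp_pow (d m : ℕ) : coeff m (exp ℂ ^ d) = (d : ℂ) ^ m / m ! := by
  rw [exp_pow_eq_rescale_exp, coeff_rescale, coeff_exp]
  simp
  ring

theorem coeff_expNeg_pow (d m : ℕ) : coeff m (expNeg ^ d) = (-1) ^ m * ((d : ℂ) ^ m / m !) := by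
  rw [expNeg, ← map_pow, evalNegHom, coeff_rescale, coeff_exp_pow]

theorem coeff_wpCoeff (n m : ℕ) : coeff m (wpCoeff n) =
    if m = 0 then -4 * ∑ d ∈ n.divisors, (d : ℂ)
    else if Even m then 2 / m ! * ∑ d ∈ n.divisors, (d : ℂ) ^ (m + 1) else 0 := by
  have h6 : (6 : ℂ⟦X⟧) = C 6 := by rw [map_ofNat]
  have h : coeff m (wpCoeff n) = ∑ d ∈ n.divisors, (d : ℂ) *
      ((d : ℂ) ^ m / m ! + (-1) ^ m * ((d : ℂ) ^ m / m !) - if m = 0 then 6 else 0) := by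
    rw [wpCoeff, map_sum]
    refine Finset.sum_congr rfl fun d _ => ?_
    rw [coeff_C_mul, map_sub, map_add, coeff_exp_pow, coeff_expNeg_pow, h6, coeff_C]
  rw [h]
  split_ifs with h0 h1
  · subst h0
    rw [Finset.mul_sum]
    refine Finset.sum_congr rfl fun d _ => ?_
    norm_num
    ring
  · rw [Finset.mul_sum]
    refine Finset.sum_congr rfl fun d _ => ?_
    rw [h1.neg_one_pow]
    ring
  · refine Finset.sum_eq_zero fun d _ => ?_
    rw [(Nat.not_even_iff_odd.mp h1).neg_one_pow]
    ring

theorem coeff_zCoth_sq (m : ℕ) : coeff m (zCoth ^ 2) =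
    (1 - m) * coeff m zCoth + if m = 2 then 1 / 4 else 0 := by
  have h := congrArg (coeff m) X_mul_deriv_zCoth
  have hd : coeff m (X * d⁄dX ℂ zCoth) = m * coeff m zCoth := by
    rcases m with _ | m
    · simp
    · rw [coeff_succ_X_mul, coeff_derivative]
      push_cast
      ring
  rw [← map_ofNat C 4, map_add, map_sub, coeff_C_mul, coeff_C_mul, coeff_C_mul, hd,
    coeff_X_pow] at h
  split_ifs at h ⊢ <;> linear_combination h / 4

theorem coeff_coeff_wpArg (n m : ℕ) : coeff n (coeff (m + 2) wpArg) =
    if m = 0 then -4 * coeff n (eisG 2) else 2 / (m ! : ℂ) * coeff n (eisG (m + 2)) := by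
  rw [wpArg, coeff_X_pow_mul, map_sub, wpRegular, coeff_mk, coeff_C]
  rcases m with _ | _ | m
  · rw [if_neg (by omega), if_pos rfl, if_pos rfl, zero_sub, map_neg, ← map_ofNat C 4,
      coeff_C_mul, neg_mul]
  · rw [eisG_of_odd (by decide)]
    simp
  · simp

/-- The `q`-expansion of `z² (℘ - 4 G_2)`; its constant term is the square of
`(z / 2) coth (z / 2)`. -/
theorem swapVars_wpArg : swapVars (1 + wpArg) = C (zCoth ^ 2) + C (X ^ 2) * wpTail := by
  ext n m
  rw [coeff_coeff_swapVars, map_add, map_add, map_add, map_add, coeff_C_mul, wpTail, coeff_mk,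
    coeff_C]
  have hX : coeff m (X ^ 2 * wpCoeff n) = if 2 ≤ m then coeff (m - 2) (wpCoeff n) else 0 :=
    coeff_X_pow_mul' _ _ _
  rw [hX]
  have hone : coeff n (coeff m (1 : ℂ⟦X⟧⟦X⟧)) = if m = 0 ∧ n = 0 then 1 else 0 := by
    rw [coeff_one]
    by_cases hm : m = 0 <;> simp [hm, coeff_one]
  rw [hone]
  rcases Nat.eq_zero_or_pos n with rfl | hn
  · have hw : wpCoeff 0 = 0 := by simp [wpCoeff]
    rw [if_pos rfl, coeff_zCoth_sq, coeff_zCoth, hw, map_zero, ite_self, add_zero]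
    rcases m with _ | _ | m
    · have : coeff 0 wpArg = 0 := by rw [coeff_zero_eq_constantCoeff_apply, constantCoeff_wpArg]
      rw [this]
      simp
    · simp [wpArg, coeff_X_pow_mul']
    · rw [coeff_coeff_wpArg, if_neg (by omega), zero_add]
      rcases Nat.eq_zero_or_pos m with rfl | hm
      · rw [coeff_eisG (by decide), eisConst]
        norm_num
      · rw [if_neg hm.ne', if_neg (show m + 1 + 1 ≠ 2 by omega), add_zero]
        by_cases he : Even m
        · have he' : Even (m + 1 + 1) := by simpa [Nat.even_add_one] using he
          have hf : (m ! : ℂ) ≠ 0 := by exact_mod_cast m.factorial_ne_zero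
          have h1 : (m : ℂ) + 1 ≠ 0 := by exact_mod_cast m.succ_ne_zero
          have h2 : (m : ℂ) + 1 + 1 ≠ 0 := by exact_mod_cast (m + 1).succ_ne_zero
          rw [if_pos he', coeff_eisG he', eisConst, if_pos rfl, Nat.factorial_succ,
            Nat.factorial_succ]
          push_cast
          field_simp
          ring
        · have he' : ¬ Even (m + 1 + 1) := by simpa [Nat.even_add_one] using he
          rw [if_neg he', eisG_of_odd (Nat.not_even_iff_odd.mp he')]
          simp
  · have hn' : n ≠ 0 := by omega
    rw [if_neg hn', map_zero, zero_add, if_neg (by omega), zero_add]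
    rcases m with _ | _ | m
    · have : coeff 0 wpArg = 0 := by rw [coeff_zero_eq_constantCoeff_apply, constantCoeff_wpArg]
      rw [this]
      simp
    · simp [wpArg, coeff_X_pow_mul']
    · rw [coeff_coeff_wpArg, if_pos (show 2 ≤ m + 1 + 1 by omega), show m + 1 + 1 - 2 = m by omega,
        coeff_wpCoeff]
      split_ifs with h0 he
      · rw [coeff_eisG (by decide), if_neg hn']
        simp
      · have he' : Even (m + 2) := by simpa [Nat.even_add_one] using he
        rw [coeff_eisG he', if_neg hn']
        rfl
      · have he' : ¬ Even (m + 2) := by simpa [Nat.even_add_one] using he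
        rw [eisG_of_odd (Nat.not_even_iff_odd.mp he')]
        simp

end Swap

/-! ### The coefficients of `q^n` -/

section Coefficients

/-- `w^d + w^(-d)`, for `w = exp z`, is a polynomial of degree at most `d` in `cosh² (z / 2)`, as
the recursion for Chebyshev polynomials shows. -/
theorem exists_aeval_coshSq_eq_exp_pow (d : ℕ) : ∃ Q : Polynomial ℂ,
    Q.natDegree ≤ d ∧ Polynomial.aeval coshSq Q = exp ℂ ^ d + expNeg ^ d := by
  have h4 := four_mul_coshSq
  have hdeg : (4 * Polynomial.X - 2 : Polynomial ℂ).natDegree ≤ 1 := by compute_degree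
  have hval : Polynomial.aeval coshSq (4 * Polynomial.X - 2 : Polynomial ℂ) = exp ℂ + expNeg := by
    rw [map_sub, map_mul, Polynomial.aeval_X, map_ofNat, map_ofNat]
    linear_combination h4
  induction d using Nat.twoStepInduction with
  | zero => exact ⟨2, by simp, by rw [map_ofNat, pow_zero, pow_zero, one_add_one_eq_two]⟩
  | one => exact ⟨4 * Polynomial.X - 2, hdeg, by rw [hval, pow_one, pow_one]⟩
  | more d h0 h1 =>
    obtain ⟨Q0, hQ0, hQ0'⟩ := h0
    obtain ⟨Q1, hQ1, hQ1'⟩ := h1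
    refine ⟨(4 * Polynomial.X - 2) * Q1 - Q0, ?_, ?_⟩
    · refine (Polynomial.natDegree_sub_le_of_le (Polynomial.natDegree_mul_le_of_le hdeg hQ1)
        hQ0).trans ?_
      omega
    · rw [map_sub, map_mul, hQ0', hQ1', hval]
      linear_combination (exp ℂ ^ d + expNeg ^ d) * exp_mul_expNeg

theorem exists_aeval_coshSq_eq_wpCoeff (n : ℕ) : ∃ Q : Polynomial ℂ,
    Q.natDegree ≤ n ∧ Polynomial.aeval coshSq Q = wpCoeff n := by
  choose Q hQ hQ' using exists_aeval_coshSq_eq_exp_pow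
  refine ⟨∑ d ∈ n.divisors, Polynomial.C (d : ℂ) * (Q d - 6), ?_, ?_⟩
  · refine Polynomial.natDegree_sum_le_of_forall_le _ _ fun d hd => ?_
    refine (Polynomial.natDegree_C_mul_le _ _).trans ?_
    refine (Polynomial.natDegree_sub_le_of_le (hQ d) (Polynomial.natDegree_ofNat 6).le).trans ?_
    simpa using Nat.divisor_le hd
  · rw [wpCoeff, map_sum]
    refine Finset.sum_congr rfl fun d _ => ?_
    rw [map_mul, map_sub, hQ', map_ofNat, Polynomial.aeval_C, PowerSeries.algebraMap_apply,
      Algebra.algebraMap_self, RingHom.id_apply]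

/-- The degree bound is uniform in `j`, because `wpCoeff m` has degree at most `m`. -/
theorem exists_aeval_coshSq_eq_coeff_wpTail_pow (n j : ℕ) : ∃ Q : Polynomial ℂ,
    Q.natDegree ≤ n ∧ Polynomial.aeval coshSq Q = coeff n (wpTail ^ j) := by
  induction j generalizing n with
  | zero =>
    rw [pow_zero, coeff_one]
    split_ifs
    · exact ⟨1, by simp, map_one _⟩
    · exact ⟨0, by simp, map_zero _⟩
  | succ j ih =>
    choose Q hQ hQ' using ih
    choose R hR hR' using exists_aeval_coshSq_eq_wpCoeff
    refine ⟨∑ p ∈ Finset.HasAntidiagonal.antidiagonal n, Q p.1 * R p.2, ?_, ?_⟩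
    · refine Polynomial.natDegree_sum_le_of_forall_le _ _ fun p hp => ?_
      rw [← Finset.HasAntidiagonal.mem_antidiagonal.mp hp]
      exact Polynomial.natDegree_mul_le_of_le (hQ _) (hR _)
    · rw [pow_succ, coeff_mul, map_sum]
      refine Finset.sum_congr rfl fun p _ => ?_
      rw [map_mul, hQ', hR', wpTail, coeff_mk]

/-- If `u` has no constant term, then the leading coefficient of `u^n` is that of `u` to the `n`. -/
theorem coeff_self_pow {R : Type*} [CommSemiring R] {u : R⟦X⟧} (hu : constantCoeff u = 0) (n : ℕ) :
    coeff n (u ^ n) = coeff 1 u ^ n := by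
  obtain ⟨v, rfl⟩ := X_dvd_iff.mpr hu
  have h := coeff_X_pow_mul (v ^ n) n 0
  rw [zero_add] at h
  rw [mul_pow, h, show (1 : ℕ) = 0 + 1 from rfl, coeff_succ_X_mul]
  simp

/-- The coefficient of `q^1` in `℘ - 4 G_2` is `w + w^(-1) - 6 = 4 cosh² (z / 2) - 8`. -/
theorem aeval_coshSq_eq_coeff_self_wpTail_pow (n : ℕ) :
    Polynomial.aeval coshSq ((4 * Polynomial.X - 8 : Polynomial ℂ) ^ n) =
      coeff n (wpTail ^ n) := by
  have h4 := four_mul_coshSq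
  rw [coeff_self_pow constantCoeff_wpTail, map_pow]
  congr 1
  rw [map_sub, map_mul, Polynomial.aeval_X, map_ofNat, map_ofNat]
  simp [wpTail, wpCoeff]
  linear_combination h4

/-- The coefficient of `q^n` of the residue, as a sum over powers of the part of `℘ - 4 G_2` of
positive degree in `q`. The bound `n ≤ k` keeps the exponents of the hyperbolic cotangent
positive. -/
theorem coeff_coeff_sqrtRegular_pow {n k : ℕ} (hnk : n ≤ k) :
    coeff n (coeff (2 * k) (sqrtRegular ^ (2 * k + 1))) =
      ∑ j ∈ Finset.range (n + 1), ((Ring.choose ((k : ℚ) + 1 / 2) j : ℚ) : ℂ) *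
        coeff (2 * (k - j)) (zCoth ^ (2 * (k - j) + 1) * coeff n (wpTail ^ j)) := by
  have hY : zCoth * zCoth⁻¹ = 1 :=
    PowerSeries.mul_inv_cancel _ (by rw [constantCoeff_zCoth]; exact one_ne_zero)
  have hCY : (C zCoth : ℂ⟦X⟧⟦X⟧) * C zCoth⁻¹ = 1 := by rw [← map_mul, hY, map_one]
  -- dividing by `(z / 2) coth (z / 2)` produces a square root of `1 + u` where `u` has no constant
  -- term in `q`
  set V : ℂ⟦X⟧⟦X⟧ := swapVars sqrtRegular * C zCoth⁻¹ with hV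
  set u : ℂ⟦X⟧⟦X⟧ := C (X ^ 2 * zCoth⁻¹ ^ 2) * wpTail with hu
  have hVu : V ^ 2 = 1 + u := by
    rw [hV, hu, mul_pow, ← map_pow, sqrtRegular_sq, swapVars_wpArg, map_mul, map_pow,
      map_pow, map_pow]
    linear_combination (C zCoth * C zCoth⁻¹ + 1) * hCY
  have hu0 : constantCoeff u = 0 := by
    rw [hu, map_mul, constantCoeff_wpTail, mul_zero]
  have hV0 : constantCoeff V = 1 := by
    refine eq_of_sq_eq_sq_of_constantCoeff (W := (1 : ℂ⟦X⟧)) ?_ ?_ (map_one _)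
    · rw [← map_pow, hVu, map_add, hu0, map_one, add_zero, one_pow]
    · have h := coeff_coeff_swapVars sqrtRegular 0 0
      simp only [coeff_zero_eq_constantCoeff_apply, constantCoeff_sqrtRegular, map_one] at h
      rw [hV, map_mul, map_mul, h, constantCoeff_C, constantCoeff_inv, constantCoeff_zCoth]
      simp
  have hswap : swapVars sqrtRegular = C zCoth * V := by
    rw [hV]
    linear_combination -swapVars sqrtRegular * hCY
  rw [← coeff_coeff_swapVars, map_pow, hswap, mul_pow, ← map_pow, coeff_C_mul,
    coeff_sqrt_pow hVu hV0 hu0, Finset.mul_sum, map_sum]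
  refine Finset.sum_congr rfl fun j hj => ?_
  have hjk : j ≤ k := by
    have := Finset.mem_range.mp hj
    omega
  have e : zCoth ^ (2 * k + 1) * coeff n (u ^ j) =
      X ^ (2 * j) * (zCoth ^ (2 * (k - j) + 1) * coeff n (wpTail ^ j)) := by
    have hYp : zCoth ^ (2 * k + 1) * zCoth⁻¹ ^ (2 * j) = zCoth ^ (2 * (k - j) + 1) := by
      rw [show 2 * k + 1 = 2 * (k - j) + 1 + 2 * j by omega, pow_add, mul_assoc, ← mul_pow, hY,
        one_pow, mul_one]
    rw [hu, mul_pow, ← map_pow, coeff_C_mul, mul_pow, ← pow_mul, ← pow_mul, ← hYp]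
    ring
  have h2 : coeff (2 * k) (X ^ (2 * j) * (zCoth ^ (2 * (k - j) + 1) * coeff n (wpTail ^ j))) =
      coeff (2 * (k - j)) (zCoth ^ (2 * (k - j) + 1) * coeff n (wpTail ^ j)) := by
    rw [show 2 * k = 2 * (k - j) + 2 * j by omega, coeff_X_pow_mul]
  rw [mul_smul_comm, e, ← Rat.cast_smul_eq_qsmul ℂ, map_smul, h2, smul_eq_mul]

end Coefficients

/-! ### Polynomial dependence on `k` -/

section Polynomiality

/-- The polynomial with value `binom(k + 1/2, j)` at `k`. -/
noncomputable def chooseHalfPoly (j : ℕ) : Polynomial ℂ :=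
  Polynomial.C ((j ! : ℂ)⁻¹) * (descPochhammer ℂ j).comp (Polynomial.X + Polynomial.C (1 / 2))

/-- The polynomial with value `binom(k - j + i, i)` at `k ≥ j`. -/
noncomputable def chooseShiftPoly (j i : ℕ) : Polynomial ℂ :=
  Polynomial.C ((i ! : ℂ)⁻¹) *
    (ascPochhammer ℂ i).comp (Polynomial.X + Polynomial.C (1 - (j : ℂ)))

theorem natDegree_chooseHalfPoly_le (j : ℕ) : (chooseHalfPoly j).natDegree ≤ j := by
  refine (Polynomial.natDegree_C_mul_le _ _).trans ?_
  rw [Polynomial.natDegree_comp, descPochhammer_natDegree, Polynomial.natDegree_X_add_C, mul_one]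

theorem natDegree_chooseShiftPoly_le (j i : ℕ) : (chooseShiftPoly j i).natDegree ≤ i := by
  refine (Polynomial.natDegree_C_mul_le _ _).trans ?_
  rw [Polynomial.natDegree_comp, ascPochhammer_natDegree, Polynomial.natDegree_X_add_C, mul_one]

theorem coeff_chooseHalfPoly_self (j : ℕ) : (chooseHalfPoly j).coeff j = (j ! : ℂ)⁻¹ := by
  have h := (monic_descPochhammer ℂ j).comp_X_add_C (1 / 2)
  have hd : ((descPochhammer ℂ j).comp (Polynomial.X + Polynomial.C (1 / 2))).natDegree = j := by
    rw [Polynomial.natDegree_comp, descPochhammer_natDegree, Polynomial.natDegree_X_add_C, mul_one]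
  have h1 := h.coeff_natDegree
  rw [hd] at h1
  rw [chooseHalfPoly, Polynomial.coeff_C_mul, h1, mul_one]

theorem coeff_chooseShiftPoly_self (j i : ℕ) : (chooseShiftPoly j i).coeff i = (i ! : ℂ)⁻¹ := by
  have h := (monic_ascPochhammer ℂ i).comp_X_add_C (1 - (j : ℂ))
  have hd : ((ascPochhammer ℂ i).comp
      (Polynomial.X + Polynomial.C (1 - (j : ℂ)))).natDegree = i := by
    rw [Polynomial.natDegree_comp, ascPochhammer_natDegree, Polynomial.natDegree_X_add_C, mul_one]
  have h1 := h.coeff_natDegree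
  rw [hd] at h1
  rw [chooseShiftPoly, Polynomial.coeff_C_mul, h1, mul_one]

theorem eval_chooseHalfPoly (j k : ℕ) : (chooseHalfPoly j).eval (k : ℂ) =
    ((Ring.choose ((k : ℚ) + 1 / 2) j : ℚ) : ℂ) := by
  rw [choose_eq_eval_descPochhammer, chooseHalfPoly, Polynomial.eval_mul, Polynomial.eval_C,
    Polynomial.eval_comp, Polynomial.eval_add, Polynomial.eval_X, Polynomial.eval_C,
    ← descPochhammer_map (algebraMap ℚ ℂ) j]
  have h : (k : ℂ) + 1 / 2 = algebraMap ℚ ℂ ((k : ℚ) + 1 / 2) := by simp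
  rw [h, Polynomial.eval_map_apply, eq_ratCast]
  push_cast
  ring

theorem eval_chooseShiftPoly {j k : ℕ} (hjk : j ≤ k) (i : ℕ) :
    (chooseShiftPoly j i).eval (k : ℂ) = ((k - j + i).choose i : ℕ) := by
  have hi : (i ! : ℂ) ≠ 0 := by exact_mod_cast i.factorial_ne_zero
  have h : (k : ℂ) + (1 - (j : ℂ)) = ((k - j + 1 : ℕ) : ℂ) := by
    push_cast [Nat.cast_sub hjk]
    ring
  rw [chooseShiftPoly, Polynomial.eval_mul, Polynomial.eval_C, Polynomial.eval_comp,
    Polynomial.eval_add, Polynomial.eval_X, Polynomial.eval_C, h, ← Nat.cast_ascFactorial,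
    Nat.ascFactorial_eq_factorial_mul_choose]
  push_cast
  field_simp

/-- The coefficient of `q^n` in `seriesA k` is, up to the stated factor, a polynomial in `k` of
degree exactly `2 n`. The top degree comes from the summand `j = n` alone. -/
theorem exists_polynomial_coeff_seriesA (n : ℕ) : ∃ p : Polynomial ℂ,
    p.degree = ((2 * n : ℕ) : WithBot ℕ) ∧ ∀ k : ℕ, n ≤ k →
      coeff n (seriesA k) = 1 / ((-4 : ℂ) ^ k * ((2 * k + 1)‼ : ℂ)) * p.eval (k : ℂ) := by
  have hdeg1 : (4 * Polynomial.X - 8 : Polynomial ℂ).natDegree ≤ 1 := by compute_degree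
  obtain ⟨Q, hQ, hQ', hQn⟩ : ∃ Q : ℕ → Polynomial ℂ, (∀ j ≤ n, (Q j).natDegree ≤ n) ∧
      (∀ j ≤ n, Polynomial.aeval coshSq (Q j) = coeff n (wpTail ^ j)) ∧
      (Q n).coeff n = 4 ^ n := by
    -- for `j = n` the polynomial is prescribed, so that its top coefficient is known
    choose R hR hR' using exists_aeval_coshSq_eq_coeff_wpTail_pow n
    refine ⟨fun j => if j = n then (4 * Polynomial.X - 8) ^ n else R j, fun j _ => ?_,
      fun j _ => ?_, ?_⟩
    · dsimp only
      split_ifs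
      · simpa using Polynomial.natDegree_pow_le_of_le n hdeg1
      · exact hR j
    · dsimp only
      split_ifs with h
      · rw [h, aeval_coshSq_eq_coeff_self_wpTail_pow]
      · exact hR' j
    · dsimp only
      rw [if_pos rfl]
      have h := Polynomial.coeff_pow_of_natDegree_le (m := n) hdeg1
      rw [mul_one] at h
      rw [h]
      congr 1
      simp [Polynomial.coeff_X, Polynomial.coeff_ofNat_succ]
  -- `(S j)(k)` is the residue of `y^(2(k-j)+1) * [q^n] wpTail^j`, up to a power of `4`
  let S (j : ℕ) : Polynomial ℂ :=
    ∑ i ∈ Finset.range (n + 1), Polynomial.C ((Q j).coeff i) * chooseShiftPoly j i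
  have hS (j : ℕ) : (S j).natDegree ≤ n := by
    refine Polynomial.natDegree_sum_le_of_forall_le _ _ fun i hi => ?_
    refine (Polynomial.natDegree_C_mul_le _ _).trans ((natDegree_chooseShiftPoly_le j i).trans ?_)
    have := Finset.mem_range.mp hi
    omega
  have hSn : (S n).coeff n = 4 ^ n * (n ! : ℂ)⁻¹ := by
    rw [Polynomial.finsetSum_coeff, Finset.sum_range_succ, Finset.sum_eq_zero, zero_add,
      Polynomial.coeff_C_mul, hQn, coeff_chooseShiftPoly_self]
    intro i hi
    rw [Polynomial.coeff_C_mul, Polynomial.coeff_eq_zero_of_natDegree_lt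
      ((natDegree_chooseShiftPoly_le n i).trans_lt (Finset.mem_range.mp hi)), mul_zero]
  let p : Polynomial ℂ :=
    ∑ j ∈ Finset.range (n + 1), Polynomial.C (4 ^ j) * (chooseHalfPoly j * S j)
  have hterm (j : ℕ) : (Polynomial.C (4 ^ j) * (chooseHalfPoly j * S j) : Polynomial ℂ).natDegree ≤
      j + n :=
    (Polynomial.natDegree_C_mul_le _ _).trans
      (Polynomial.natDegree_mul_le_of_le (natDegree_chooseHalfPoly_le j) (hS j))
  have hp : p.natDegree ≤ 2 * n := by
    refine Polynomial.natDegree_sum_le_of_forall_le _ _ fun j hj => (hterm j).trans ?_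
    have := Finset.mem_range.mp hj
    omega
  have hpc : p.coeff (2 * n) = 4 ^ n * ((n ! : ℂ)⁻¹ * (4 ^ n * (n ! : ℂ)⁻¹)) := by
    rw [Polynomial.finsetSum_coeff, Finset.sum_range_succ, Finset.sum_eq_zero, zero_add,
      Polynomial.coeff_C_mul, two_mul,
      Polynomial.coeff_mul_add_eq_of_natDegree_le (natDegree_chooseHalfPoly_le n) (hS n),
      coeff_chooseHalfPoly_self, hSn]
    intro j hj
    refine Polynomial.coeff_eq_zero_of_natDegree_lt ((hterm j).trans_lt ?_)
    have := Finset.mem_range.mp hj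
    omega
  have hfac : (n ! : ℂ) ≠ 0 := by exact_mod_cast n.factorial_ne_zero
  refine ⟨p, Polynomial.degree_eq_of_le_of_coeff_ne_zero
    (Polynomial.natDegree_le_iff_degree_le.mp hp) ?_, fun k hk => ?_⟩
  · rw [hpc]
    have h4 : (4 : ℂ) ^ n ≠ 0 := pow_ne_zero _ (by norm_num)
    exact mul_ne_zero h4 (mul_ne_zero (inv_ne_zero hfac) (mul_ne_zero h4 (inv_ne_zero hfac)))
  · have hk4 : (4 : ℂ) ^ k ≠ 0 := pow_ne_zero _ (by norm_num)
    have hval : 4 ^ k * coeff n (coeff (2 * k) (sqrtRegular ^ (2 * k + 1))) = p.eval (k : ℂ) := by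
      rw [coeff_coeff_sqrtRegular_pow hk, Finset.mul_sum, Polynomial.eval_finsetSum]
      refine Finset.sum_congr rfl fun j hj => ?_
      have hj' : j ≤ n := by
        have := Finset.mem_range.mp hj
        omega
      have h := coeff_zCoth_pow_mul_aeval (hQ j hj') (k - j)
      rw [hQ' j hj'] at h
      have hSe : (S j).eval (k : ℂ) =
          ∑ i ∈ Finset.range (n + 1), (Q j).coeff i * (k - j + i).choose i := by
        rw [Polynomial.eval_finsetSum]
        refine Finset.sum_congr rfl fun i _ => ?_
        rw [Polynomial.eval_mul, Polynomial.eval_C, eval_chooseShiftPoly (hj'.trans hk)]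
      rw [Polynomial.eval_mul, Polynomial.eval_mul, Polynomial.eval_C, hSe, ← h,
        eval_chooseHalfPoly]
      have h4 : (4 : ℂ) ^ k = 4 ^ j * 4 ^ (k - j) := by
        rw [← pow_add, Nat.add_sub_cancel' (hj'.trans hk)]
      rw [h4]
      ring
    have hdf : (((2 * k + 1)‼ : ℕ) : ℂ) ≠ 0 := by
      exact_mod_cast (Nat.doubleFactorial_pos _).ne'
    rw [seriesA_eq, map_smul, smul_eq_mul, ← hval, neg_pow (4 : ℂ) k]
    have h1 : ((-1 : ℂ) ^ k) * (-1) ^ k = 1 := by rw [← mul_pow]; norm_num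
    have h1' : ((-1 : ℂ) ^ k) ≠ 0 := left_ne_zero_of_mul_eq_one h1
    field_simp
    linear_combination (coeff n (coeff (2 * k) (sqrtRegular ^ (2 * k + 1)))) * h1

theorem isPolynomialQuasimodularSequence_seriesA : IsPolynomialQuasimodularSequence seriesA where
  quasimodular k := ⟨polyA k, isWeightedHomogeneous_polyA k, evalG_polyA k⟩
  deriv_zero := by
    rw [← evalG_polyA, hasDerivG2_iff, pderiv_polyA_zero, map_zero]
  deriv_succ k := by
    rw [← evalG_polyA, ← evalG_polyA, hasDerivG2_iff, pderiv_polyA_succ, map_mul, map_ofNat]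
  polynomial := exists_polynomial_coeff_seriesA
  normalized := by
    rw [seriesA_eq, mul_zero, zero_add, pow_one]
    simp [constantCoeff_sqrtRegular]

end Polynomiality

/-! ### Uniqueness -/

section Uniqueness

open UpperHalfPlane ModularForm MatrixGroups

/-- Two quasimodular forms of weight `w` with the same derivative along `G_2` differ by a modular
form of weight `w`. -/
theorem exists_modularForm_sub {w : ℕ} {f f' g : ℂ⟦X⟧} (hf : IsQuasimodular w f)
    (hf' : IsQuasimodular w f') (hg : HasDerivG2 f g) (hg' : HasDerivG2 f' g) :
    ∃ h : ModularForm 𝒮ℒ (w : ℤ), UpperHalfPlane.qExpansion 1 h = f - f' := by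
  obtain ⟨P, hP, rfl⟩ := hf
  obtain ⟨P', hP', rfl⟩ := hf'
  rw [hasDerivG2_iff] at hg hg'
  rw [← map_sub]
  refine exists_modularForm_of_pderiv_eq_zero (hP.sub hP') ?_
  rw [map_sub, sub_eq_zero]
  exact evalG_injective (hg.trans hg'.symm)

variable {A B : ℕ → ℂ⟦X⟧}

/-- If two sequences agree up to index `m`, then so do the coefficients of `q^n` at `m` as long as
`m > 3 n`: the polynomials of degree `2 n` agree at the `m - n ≥ 2 n + 1` points `n, …, m - 1`. -/
theorem coeff_eq_of_forall_lt (hA : IsPolynomialQuasimodularSequence A)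
    (hB : IsPolynomialQuasimodularSequence B) {m n : ℕ} (hAB : ∀ k < m, A k = B k)
    (hn : 3 * n < m) : coeff n (A m) = coeff n (B m) := by
  obtain ⟨p, hp, hpA⟩ := hA.polynomial n
  obtain ⟨p', hp', hpB⟩ := hB.polynomial n
  have hpp : p = p' := by
    refine Polynomial.eq_of_degrees_lt_of_eval_finset_eq
      ((Finset.Ico n m).map ⟨((↑) : ℕ → ℂ), Nat.cast_injective⟩) ?_ ?_ ?_
    · rw [hp, Finset.card_map, Nat.card_Ico]
      exact_mod_cast (show 2 * n < m - n by omega)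
    · rw [hp', Finset.card_map, Nat.card_Ico]
      exact_mod_cast (show 2 * n < m - n by omega)
    · intro x hx
      obtain ⟨k, hk, rfl⟩ := Finset.mem_map.mp hx
      rw [Finset.mem_Ico] at hk
      have h4 : (-4 : ℂ) ^ k ≠ 0 := pow_ne_zero _ (by norm_num)
      have hdf : (((2 * k + 1)‼ : ℕ) : ℂ) ≠ 0 := by
        exact_mod_cast (Nat.doubleFactorial_pos _).ne'
      have h := hpA k hk.1
      rw [hAB k hk.2, hpB k hk.1] at h
      exact (mul_left_cancel₀ (one_div_ne_zero (mul_ne_zero h4 hdf)) h).symm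
  rw [hpA m (by omega), hpB m (by omega), hpp]

theorem eq_of_isPolynomialQuasimodularSequence (hA : IsPolynomialQuasimodularSequence A)
    (hB : IsPolynomialQuasimodularSequence B) : A = B := by
  funext m
  induction m using Nat.strong_induction_on with
  | _ m ih =>
  obtain ⟨h, hh⟩ : ∃ h : ModularForm 𝒮ℒ ((2 * m : ℕ) : ℤ),
      UpperHalfPlane.qExpansion 1 h = A m - B m := by
    refine exists_modularForm_sub (g := if m = 0 then 0 else 2 * A (m - 1))
      (hA.quasimodular m) (hB.quasimodular m) ?_ ?_
    · rcases m with _ | m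
      · exact hA.deriv_zero
      · exact hA.deriv_succ m
    · rcases m with _ | m
      · exact hB.deriv_zero
      · rw [if_neg m.succ_ne_zero, Nat.add_sub_cancel, ih m m.lt_succ_self]
        exact hB.deriv_succ m
  have hcoeff (n : ℕ) (hn : n ≤ 2 * m / 12) : coeff n (A m - B m) = 0 := by
    rw [map_sub, sub_eq_zero]
    rcases Nat.eq_zero_or_pos m with rfl | hm
    · obtain rfl : n = 0 := by omega
      rw [hA.normalized, hB.normalized]
    · exact coeff_eq_of_forall_lt hA hB ih (by omega)
  have h0 : h = 0 := by
    refine sturm_bound_levelOne_nat ?_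
    rw [hh]
    refine lt_of_lt_of_le ?_ (nat_le_order _ (2 * m / 12 + 1) fun i hi => hcoeff i (by omega))
    exact_mod_cast Nat.lt_succ_self _
  rw [h0] at hh
  exact sub_eq_zero.mp (hh.symm.trans (UpperHalfPlane.qExpansion_zero 1))

end Uniqueness

theorem mainTheorem6 :
    IsPolynomialQuasimodularSequence seriesA ∧
      ∀ A : ℕ → PowerSeries ℂ, IsPolynomialQuasimodularSequence A → A = seriesA := by
  exact ⟨isPolynomialQuasimodularSequence_seriesA, fun A hA =>
    eq_of_isPolynomialQuasimodularSequence hA isPolynomialQuasimodularSequence_seriesA⟩
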